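/- **Setting.** Let $n\ge 1$, $f:\mathbb R^n\to\mathbb R$, and consider $\min f(x)$ subject to $x\ge 0$. $\|\cdot\|$ is the Euclidean norm and the induced operator norm, $e=(1,\dots,1)^\top$, $\bar x=\min(x,e)$, $X=\mathrm{diag}(x)$, $\bar X=\mathrm{diag}(\bar x)$, $\phi_\mu(x)=f(x)-\mu\sum_i\log x_i$, and $\mathrm{sgn}(t)=-1$ for $t<0$, $\mathrm{sgn}(t)=1$ for $t\ge 0$. **Log-barrier Newton-CG algorithm.** Inputs: $\epsilon_g,\theta,\zeta_r,\bar\zeta,\eta\in(0,1)$, $\beta\in[\epsilon_g^{1/2},1)$, a starting point $x^0>0$, and $\hat M\ge 0$ ($\hat M=0$ if no bound on $\|\nabla^2 f\|$ is supplied). Set $\epsilon_H=\epsilon_g^{1/2}$, $\mu=\epsilon_g/4$, $c_\mu=\bar\zeta\mu$, $M_\mu=\hat M+\mu$. Iteration $k$ at $x=x^k$, with $g=\bar X\nabla\phi_\mu(x)$ and $H=\bar X\nabla^2\phi_\mu(x)\bar X$: * If $[\nabla f(x)]_i\le-\epsilon_g$ for some $i$, or $\|\bar X\nabla f(x)\|_\infty>\epsilon_g$,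 call capped CG (below) with $(H,g,\epsilon=\epsilon_H,\zeta_r,c_\mu,M=M_\mu)$ to get a flag and $\hat d$. If the flag is NC, $d^k=-\mathrm{sgn}(g^\top\hat d)\min\{|\hat d^\top H\hat d|/\|\hat d\|^3,\ \beta/\|X^{-1}\bar X\hat d\|_\infty\}\hat d$; if it is SOL, $d^k=\min\{1,\ \beta/\|X^{-1}\bar X\hat d\|_\infty\}\hat d$. * Otherwise a minimum eigenvalue oracle either leads to termination or returns some $v$ with $\|v\|=1$ and $v^\top\bar X\nabla^2 f(x)\bar Xv\le-\epsilon_H/2$, and then $d^k=-\mathrm{sgn}(v^\top g)\min\{|v^\top Hv|,\ \beta/\|X^{-1}\bar Xv\|_\infty\}v$. * $x^{k+1}=x^k+\theta^{j}\bar Xd^k$, where $j\ge 0$ is the smallest integer with $\phi_\mu(x^k+\theta^j\bar Xd^k)<\phi_\mu(x^k)-\frac{\eta}{6}\theta^{3j}\|d^k\|^3$. **Capped CG.** Put $\bar H=H+2\epsilon I$ and, for the current $M$, $\kappa=(M+2\epsilon)/\epsilon$, $\hat\zeta_r=\zeta_r/(3\kappa)$, $\tau=\sqrt\kappa/(\sqrt\kappa+1)$,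 $T=4\kappa^4/(1-\sqrt\tau)^2$. Start from $y^0=0$, $r^0=g$, $p^0=-g$. If $(p^0)^\top\bar Hp^0<\epsilon\|p^0\|^2$ return (NC, $p^0$); else, if $\|Hp^0\|>M\|p^0\|$, set $M=\|Hp^0\|/\|p^0\|$. Then for $j=1,2,\dots$ compute $\alpha_{j-1}=\|r^{j-1}\|^2/((p^{j-1})^\top\bar Hp^{j-1})$, $y^j=y^{j-1}+\alpha_{j-1}p^{j-1}$, $r^j=r^{j-1}+\alpha_{j-1}\bar Hp^{j-1}$, $p^j=-r^j+(\|r^j\|^2/\|r^{j-1}\|^2)p^{j-1}$; test $v=p^j$, $v=y^j$, $v=r^j$ in this order, setting $M=\|Hv\|/\|v\|$ whenever $\|Hv\|>M\|v\|$; and apply the first of the following rules whose condition holds (if none does, go on to the next $j$): (1) if $(y^j)^\top\bar Hy^j<\epsilon\|y^j\|^2$, return (NC, $y^j$); (2) if $\|r^j\|\le\hat\zeta_r\|r^0\|$ and $\|r^j\|_\infty\le c_\mu$, return (SOL, $y^j$); (3) if $(p^j)^\top\bar Hp^j<\epsilon\|p^j\|^2$, return (NC, $p^j$); (4) if $\|r^j\|>\sqrt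 T\,\tau^{j/2}\|r^0\|$, compute $y^{j+1}$, find $i\in\{0,\dots,j-1\}$ such that $v=y^{j+1}-y^i$ satisfies $v^\top\bar Hv<\epsilon\|v\|^2$, and return (NC, $v$). The three tests that enlarge $M$ may be organised as three consecutive "if" statements or as one "if / else if / else if" chain, in which only the first test that holds takes effect. **Assumptions.** $f(x)\ge f_{\rm low}$ for all $x>0$, and $L_H>0$. An execution of the algorithm is considered, that is, its first $N\ge 0$ iterations with iterates $x^0,\dots,x^N$ and directions $d^0,\dots,d^{N-1}$. On some open set that contains its iterates and the segments $[x^k,x^k+\bar X_kd^k]$, $k<N$ (on which the trial points lie), as well as the segments $[x^N,x^N+\bar X_Nd]$ for all directions $d$ that can be computed at $x^N$, the function $f$ is twice continuously differentiable and $\nabla^2f$ is $L_H$-Lipschitz. **Constants.** $$c_d=\min\Big\{\tfrac{1-\bar\zeta}{9},\sqrt{\tfrac{3}{2L_H}},\tfrac{1}{2(L_H+9/2+\zeta_r)}\Big\},\quad c_{\rm sol}=\min\Big\{c_d,\tfrac{6(1-\beta)^2\theta^2}{(L_H+\eta)(1-\beta)^2+(2-\beta)}\Big\},\quad c_{\rm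 nc}=\min\Big\{1,\tfrac{3(1-\beta)^2\theta}{(L_H+\eta)(1-\beta)^2+(2-\beta)}\Big\},$$ $$c_{\rm all}=\min\{c_{\rm sol},c_{\rm nc}\},\qquad \omega_1=\max\Big\{\tfrac{3\sqrt n}{\eta c_{\rm all}^2},\|x^0\|_\infty\Big\},$$ $$\bar K_1=\Big\lceil\frac{12\big(\mu n(\log\omega_1-\min_i\log x^0_i)+f(x^0)-f_{\rm low}\big)}{\eta c_{\rm all}^3}\,\epsilon_g^{-3/2}\Big\rceil .$$ **Theorem.** (a) If $N\ge\bar K_1+1$, then, deterministically, some iterate $x^k$ with $0\le k\le\bar K_1+1$ satisfies $x^k>0$ and $$\nabla f(x^k)\ge-\epsilon_g e,\qquad \|\bar X_k\nabla f(x^k)\|_\infty\le\epsilon_g .\qquad(*)$$ (b) The algorithm does not break down before: if $x^N$ violates $(*)$, then, provided that the tests that enlarge $M$ are consecutive or $\|\nabla^2 f(x^N)\|\le\hat M$, capped CG terminates at $x^N$ and yields a search direction; and, without this proviso, the line search terminates along every search direction that can be computed at $x^N$. (c) $\bar K_1=\tilde{\mathcal O}(n\epsilon_g^{-1/2}+\epsilon_g^{-3/2})$: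 for all fixed $\theta,\zeta_r,\bar\zeta,\beta,\eta,L_H$ and all real $0<\ell$, $u$, $\Delta$ there is a constant $C$ such that, for all $\epsilon_g\in(0,1)$, $n\ge1$, $x^0\in[\ell,u]^n$ and all values $f(x^0)-f_{\rm low}\le\Delta$, $$\bar K_1\le C\big(n(1+\log n)\,\epsilon_g^{-1/2}+\epsilon_g^{-3/2}\big).$$ -/

import Mathlib

namespace LBNCG

/-- `ℝⁿ` with the Euclidean norm. -/
abbrev E (n : ℕ) : Type := EuclideanSpace ℝ (Fin n)

/-! ### Vectors, scalings, barrier function -/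

/-- The `ℓ^∞` norm (the norm of `Fin n → ℝ` is the sup norm). -/
noncomputable def supNorm {n : ℕ} (v : E n) : ℝ := ‖v.ofLp‖

/-- `diag a` as an operator on `ℝⁿ`. -/
noncomputable def diag {n : ℕ} (a : E n) : E n →L[ℝ] E n :=
  Matrix.toEuclideanCLM (n := Fin n) (𝕜 := ℝ) (Matrix.diagonal a.ofLp)

/-- `x̄ = min (x, e)`. -/
noncomputable def capped {n : ℕ} (x : E n) : E n := WithLp.toLp 2 fun i => min (x i) 1

/-- `X⁻¹`, used at points with positive coordinates only. -/
noncomputable def inverseDiag {n : ℕ} (x : E n) : E n →L[ℝ] E n :=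
  diag (WithLp.toLp 2 fun i => (x i)⁻¹)

/-- The Hessian `∇²f(x)`, the derivative of the gradient map. Its norm is the induced
Euclidean norm. -/
noncomputable def hess {n : ℕ} (f : E n → ℝ) (x : E n) : E n →L[ℝ] E n :=
  fderiv ℝ (gradient f) x

/-- The log-barrier function `φ_μ(x) = f(x) - μ ∑ log x_i`. -/
noncomputable def barrier {n : ℕ} (f : E n → ℝ) (μ : ℝ) (x : E n) : ℝ :=
  f x - μ * ∑ i, Real.log (x i)

/-- `X̄ A X̄`. -/
noncomputable def scaled {n : ℕ} (x : E n) (A : E n →L[ℝ] E n) : E n →L[ℝ] E n :=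
  (diag (capped x)).comp (A.comp (diag (capped x)))

/-- `sgn`, with values in `{-1, 1}`. -/
noncomputable def sgn (t : ℝ) : ℝ := if t < 0 then -1 else 1

/-! ### Capped conjugate gradient -/

/-- The flag `d_type`. -/
inductive DType
  | nc
  | sol

/-- How the three tests on `p^j`, `y^j`, `r^j` that enlarge `M` are organised: as one
`if / else if / else if` chain, or as three consecutive `if`s. -/
inductive NormTests
  | chained
  | consecutive

/-- One test: if `‖H v‖ > M ‖v‖`, then `M ← ‖H v‖ / ‖v‖`. -/
noncomputable def raise {n : ℕ} (H : E n →L[ℝ] E n) (M : ℝ) (v : E n) : ℝ :=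
  if M * ‖v‖ < ‖H v‖ then ‖H v‖ / ‖v‖ else M

/-- The update of `M` in one pass of the main loop. -/
noncomputable def updateM {n : ℕ} (H : E n →L[ℝ] E n) (M : ℝ) (p y r : E n) :
    NormTests → ℝ
  | .chained =>
      if M * ‖p‖ < ‖H p‖ then ‖H p‖ / ‖p‖
      else if M * ‖y‖ < ‖H y‖ then ‖H y‖ / ‖y‖
      else if M * ‖r‖ < ‖H r‖ then ‖H r‖ / ‖r‖
      else M
  | .consecutive => raise H (raise H (raise H M p) y) r

/-- The variables of the main loop. -/
structure CGState (n : ℕ) where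
  y : E n
  r : E n
  p : E n
  M : ℝ

/-- `H̄ = H + 2 ε I`. -/
noncomputable def damped {n : ℕ} (H : E n →L[ℝ] E n) (ε : ℝ) : E n →L[ℝ] E n :=
  H + (2 * ε) • ContinuousLinearMap.id ℝ (E n)

/-- The CG step length `α_j`. -/
noncomputable def cgAlpha {n : ℕ} (Hb : E n →L[ℝ] E n) (s : CGState n) : ℝ :=
  inner ℝ s.r s.r / inner ℝ s.p (Hb s.p)

/-- The standard CG operations, followed by the update of `M`. -/
noncomputable def cgNext {n : ℕ} (t : NormTests) (H : E n →L[ℝ] E n) (ε : ℝ)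
    (s : CGState n) : CGState n :=
  let α := cgAlpha (damped H ε) s
  let y := s.y + α • s.p
  let r := s.r + α • damped H ε s.p
  let p := -r + (‖r‖ ^ 2 / ‖s.r‖ ^ 2) • s.p
  ⟨y, r, p, updateM H s.M p y r t⟩

/-- `y^j, r^j, p^j` and the value of `M` after the tests at index `j`. -/
noncomputable def cg {n : ℕ} (t : NormTests) (H : E n →L[ℝ] E n) (g : E n) (ε M : ℝ) :
    ℕ → CGState n
  | 0 => ⟨0, g, -g, raise H M (-g)⟩
  | j + 1 => cgNext t H ε (cg t H g ε M j)

noncomputable def kappa (ε M : ℝ) : ℝ := (M + 2 * ε) / ε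

/-- `ζ̂_r`. -/
noncomputable def zetaHat (ζr ε M : ℝ) : ℝ := ζr / (3 * kappa ε M)

noncomputable def tau (ε M : ℝ) : ℝ := √(kappa ε M) / (√(kappa ε M) + 1)

noncomputable def bigT (ε M : ℝ) : ℝ := 4 * kappa ε M ^ 4 / (1 - √(tau ε M)) ^ 2

/-- `vᵀ H̄ v < ε ‖v‖²`; this forces `v ≠ 0`. -/
def LowCurv {n : ℕ} (Hb : E n →L[ℝ] E n) (ε : ℝ) (v : E n) : Prop :=
  inner ℝ v (Hb v) < ε * ‖v‖ ^ 2

/-- `‖r^j‖ ≤ ζ̂_r ‖r^0‖` and `‖r^j‖_∞ ≤ c`. -/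
def SmallResidual {n : ℕ} (g : E n) (ε ζr c : ℝ) (s : CGState n) : Prop :=
  ‖s.r‖ ≤ zetaHat ζr ε s.M * ‖g‖ ∧ supNorm s.r ≤ c

/-- `‖r^j‖ > √T τ^{j/2} ‖r^0‖`. -/
def SlowDecrease {n : ℕ} (g : E n) (ε : ℝ) (j : ℕ) (s : CGState n) : Prop :=
  √(bigT ε s.M) * tau ε s.M ^ ((j : ℝ) / 2) * ‖g‖ < ‖s.r‖

/-- The outcome of the four termination tests at index `j ≥ 1`: `StopAt … j flag d` says that
the first test that holds at `j` leads to the output `(flag, d)`. -/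
inductive StopAt {n : ℕ} (t : NormTests) (H : E n →L[ℝ] E n) (g : E n) (ε ζr c M : ℝ)
    (j : ℕ) : DType → E n → Prop
  | y_curv (h1 : LowCurv (damped H ε) ε (cg t H g ε M j).y) :
      StopAt t H g ε ζr c M j .nc (cg t H g ε M j).y
  | solved (h1 : ¬ LowCurv (damped H ε) ε (cg t H g ε M j).y)
      (h2 : SmallResidual g ε ζr c (cg t H g ε M j)) :
      StopAt t H g ε ζr c M j .sol (cg t H g ε M j).y
  | p_curv (h1 : ¬ LowCurv (damped H ε) ε (cg t H g ε M j).y)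
      (h2 : ¬ SmallResidual g ε ζr c (cg t H g ε M j))
      (h3 : LowCurv (damped H ε) ε (cg t H g ε M j).p) :
      StopAt t H g ε ζr c M j .nc (cg t H g ε M j).p
  | slow (h1 : ¬ LowCurv (damped H ε) ε (cg t H g ε M j).y)
      (h2 : ¬ SmallResidual g ε ζr c (cg t H g ε M j))
      (h3 : ¬ LowCurv (damped H ε) ε (cg t H g ε M j).p)
      (h4 : SlowDecrease g ε j (cg t H g ε M j))
      (i : ℕ) (hi : i < j)
      (h5 : LowCurv (damped H ε) ε ((cg t H g ε M (j + 1)).y - (cg t H g ε M i).y)) :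
      StopAt t H g ε ζr c M j .nc ((cg t H g ε M (j + 1)).y - (cg t H g ε M i).y)

/-- None of the four termination tests holds at index `j`: the loop goes on. -/
def Continues {n : ℕ} (t : NormTests) (H : E n →L[ℝ] E n) (g : E n) (ε ζr c M : ℝ)
    (j : ℕ) : Prop :=
  ¬ LowCurv (damped H ε) ε (cg t H g ε M j).y ∧
  ¬ SmallResidual g ε ζr c (cg t H g ε M j) ∧
  ¬ LowCurv (damped H ε) ε (cg t H g ε M j).p ∧
  ¬ SlowDecrease g ε j (cg t H g ε M j)

/-- `CappedCG … flag d`: capped CG terminates and `(flag, d)` is a possible output (the only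
freedom is the choice of `i` in the last termination test). -/
inductive CappedCG {n : ℕ} (t : NormTests) (H : E n →L[ℝ] E n) (g : E n) (ε ζr c M : ℝ) :
    DType → E n → Prop
  | initial (h : LowCurv (damped H ε) ε (-g)) : CappedCG t H g ε ζr c M .nc (-g)
  | loop (h : ¬ LowCurv (damped H ε) ε (-g)) (j : ℕ) (hj : 1 ≤ j)
      (hcont : ∀ i, 1 ≤ i → i < j → Continues t H g ε ζr c M i)
      (flag : DType) (d : E n) (hout : StopAt t H g ε ζr c M j flag d) :
      CappedCG t H g ε ζr c M flag d

/-! ### The log-barrier Newton-CG algorithm -/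

/-- The scalar inputs of the algorithm; `Mhat = 0` if no bound on the Hessian is provided. -/
structure Params where
  εg : ℝ
  θ : ℝ
  ζr : ℝ
  ζbar : ℝ
  β : ℝ
  η : ℝ
  Mhat : ℝ

/-- The admissible ranges of the inputs. -/
structure Params.Valid (P : Params) : Prop where
  εg_pos : 0 < P.εg
  εg_lt : P.εg < 1
  θ_pos : 0 < P.θ
  θ_lt : P.θ < 1
  ζr_pos : 0 < P.ζr
  ζr_lt : P.ζr < 1
  ζbar_pos : 0 < P.ζbar
  ζbar_lt : P.ζbar < 1
  β_ge : √P.εg ≤ P.β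
  β_lt : P.β < 1
  η_pos : 0 < P.η
  η_lt : P.η < 1
  Mhat_nonneg : 0 ≤ P.Mhat

/-- `ε_H = ε_g^{1/2}`. -/
noncomputable def Params.εH (P : Params) : ℝ := √P.εg

/-- `μ = ε_g / 4`. -/
noncomputable def Params.μ (P : Params) : ℝ := P.εg / 4

/-- `c_μ = ζ̄ μ`. -/
noncomputable def Params.cμ (P : Params) : ℝ := P.ζbar * P.μ

/-- `M_μ = M̂ + μ`. -/
noncomputable def Params.Mμ (P : Params) : ℝ := P.Mhat + P.μ

/-- The test that sends an iteration to capped CG. -/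
def CallsCG {n : ℕ} (P : Params) (f : E n → ℝ) (x : E n) : Prop :=
  (∃ i, gradient f x i ≤ -P.εg) ∨ P.εg < supNorm (diag (capped x) (gradient f x))

/-- `X̄ ∇φ_μ(x)`. -/
noncomputable def sGrad {n : ℕ} (P : Params) (f : E n → ℝ) (x : E n) : E n :=
  diag (capped x) (gradient (barrier f P.μ) x)

/-- `X̄ ∇²φ_μ(x) X̄`. -/
noncomputable def sHess {n : ℕ} (P : Params) (f : E n → ℝ) (x : E n) : E n →L[ℝ] E n :=
  scaled x (hess (barrier f P.μ) x)

/-- `β / ‖X⁻¹ X̄ v‖_∞`. -/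
noncomputable def maxStep {n : ℕ} (P : Params) (x v : E n) : ℝ :=
  P.β / supNorm (inverseDiag x (diag (capped x) v))

/-- `SearchDir P t f x d`: the search direction `d^k` computed at the iterate `x` can be `d`.
In the last case `v` is a direction returned by the minimum eigenvalue oracle; nothing is
required of the oracle's other possible answer, after which the algorithm terminates. -/
inductive SearchDir {n : ℕ} (P : Params) (t : NormTests) (f : E n → ℝ) (x : E n) :
    E n → Prop
  | nc (hx : CallsCG P f x) (v : E n)
      (hv : CappedCG t (sHess P f x) (sGrad P f x) P.εH P.ζr P.cμ P.Mμ .nc v) :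
      SearchDir P t f x
        ((-sgn (inner ℝ (sGrad P f x) v) *
          min (|inner ℝ v (sHess P f x v)| / ‖v‖ ^ 3) (maxStep P x v)) • v)
  | sol (hx : CallsCG P f x) (v : E n)
      (hv : CappedCG t (sHess P f x) (sGrad P f x) P.εH P.ζr P.cμ P.Mμ .sol v) :
      SearchDir P t f x (min 1 (maxStep P x v) • v)
  | oracle (hx : ¬ CallsCG P f x) (v : E n) (hv1 : ‖v‖ = 1)
      (hv2 : inner ℝ v (scaled x (hess f x) v) ≤ -P.εH / 2) :
      SearchDir P t f x
        ((-sgn (inner ℝ v (sGrad P f x)) *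
          min |inner ℝ v (sHess P f x v)| (maxStep P x v)) • v)

/-- The acceptance test for the step length `θ^j`. -/
def Accepts {n : ℕ} (P : Params) (f : E n → ℝ) (x d : E n) (j : ℕ) : Prop :=
  barrier f P.μ (x + P.θ ^ j • diag (capped x) d) <
    barrier f P.μ x - P.η / 6 * (P.θ ^ j) ^ 3 * ‖d‖ ^ 3

/-- The backtracking line search from `x` along `X̄ d` terminates and its result is `x'`. -/
def LineSearch {n : ℕ} (P : Params) (f : E n → ℝ) (x d x' : E n) : Prop :=
  ∃ j : ℕ, Accepts P f x d j ∧ (∀ i < j, ¬ Accepts P f x d i) ∧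
    x' = x + P.θ ^ j • diag (capped x) d

/-- The first `N` iterations of an execution from `x0`, with iterates `x 0, …, x N` and search
directions `d 0, …, d (N - 1)`. -/
def Execution {n : ℕ} (P : Params) (t : NormTests) (f : E n → ℝ) (x0 : E n) (N : ℕ)
    (x d : ℕ → E n) : Prop :=
  x 0 = x0 ∧ ∀ k < N, SearchDir P t f (x k) (d k) ∧ LineSearch P f (x k) (d k) (x (k + 1))

/-- The segment from `x` to `x + X̄ d`, which contains all trial points along `d`. -/
def trialPath {n : ℕ} (x d : E n) : Set (E n) := segment ℝ x (x + diag (capped x) d)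

/-- `U` contains the iterates and all trial points of the given `N` iterations, and all trial
points of an iteration started at the last iterate. -/
def CoversPath {n : ℕ} (P : Params) (t : NormTests) (f : E n → ℝ) (U : Set (E n)) (N : ℕ)
    (x d : ℕ → E n) : Prop :=
  (∀ k < N, trialPath (x k) (d k) ⊆ U) ∧ x N ∈ U ∧
    ∀ v, SearchDir P t f (x N) v → trialPath (x N) v ⊆ U

/-- `f` is twice continuously differentiable on the open set `U`, with `LH`-Lipschitz
Hessian there. -/
def LipschitzHessianOn {n : ℕ} (f : E n → ℝ) (LH : ℝ) (U : Set (E n)) : Prop :=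
  IsOpen U ∧ ContDiffOn ℝ 2 f U ∧ ∀ x ∈ U, ∀ y ∈ U, ‖hess f x - hess f y‖ ≤ LH * ‖x - y‖

/-- `∇f(x) ≥ -ε e` and `‖X̄ ∇f(x)‖_∞ ≤ ε`. -/
def FirstOrder {n : ℕ} (f : E n → ℝ) (ε : ℝ) (x : E n) : Prop :=
  (∀ i, -ε ≤ gradient f x i) ∧ supNorm (diag (capped x) (gradient f x)) ≤ ε

/-! ### The constants of the bound -/

noncomputable def Params.cd (P : Params) (LH : ℝ) : ℝ :=
  min ((1 - P.ζbar) / 9) (min √(3 / (2 * LH)) (1 / (2 * (LH + 9 / 2 + P.ζr))))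

noncomputable def Params.csol (P : Params) (LH : ℝ) : ℝ :=
  min (P.cd LH)
    (6 * (1 - P.β) ^ 2 * P.θ ^ 2 / ((LH + P.η) * (1 - P.β) ^ 2 + (2 - P.β)))

noncomputable def Params.cnc (P : Params) (LH : ℝ) : ℝ :=
  min 1 (3 * (1 - P.β) ^ 2 * P.θ / ((LH + P.η) * (1 - P.β) ^ 2 + (2 - P.β)))

noncomputable def Params.call (P : Params) (LH : ℝ) : ℝ := min (P.csol LH) (P.cnc LH)

noncomputable def omega1 {n : ℕ} (P : Params) (LH : ℝ) (x0 : E n) : ℝ :=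
  max (3 * √n / (P.η * P.call LH ^ 2)) (supNorm x0)

/-- `K̄₁`, where `Δ` stands for `f(x⁰) - f_low`. -/
noncomputable def K1 {n : ℕ} (P : Params) (LH : ℝ) (x0 : E n) (Δ : ℝ) : ℕ :=
  ⌈12 * (P.μ * n * (Real.log (omega1 P LH x0) - ⨅ i, Real.log (x0 i)) + Δ) /
      (P.η * P.call LH ^ 3) * P.εg ^ (-(3 / 2) : ℝ)⌉₊

end LBNCG

/-! The barrier function serves as potential. By `barrier_step_le` it is bounded along a search
direction by its scaled quadratic model plus a cubic term: the Lipschitz Hessian handles `f`, and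
since the cut-back by `β` keeps relative displacements below `β < 1`, the logarithms have a cubic
remainder too. At a point violating (*) the direction comes from capped CG, and is either of
negative curvature (`IsNegCurv`) or an approximate Newton step (`IsNewton`). In both cases the model
beats the cubic term once `θ^j` is small, so the line search stops, and rejection of the previous
trial bounds the accepted length below by `c_all ε_H`. The one exception (`long_step_or_newton`) is
a full Newton step with `‖d‖ < c_d ε_H`; there the small CG residual forces the gradient at the new
point to satisfy (*) (`firstOrder_of_short_newton`).

Hence an iteration between two points violating (*) lowers the barrier function by `η s³ / 6` for
some `s ≥ c_all ε_H` that bounds the displacement. The barrier function need not be bounded below,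
since the logarithms may grow. In `exists_firstOrder` half of each decrease pays for that growth,
which is linear in the path length with a slope made small by `ω₁`; the other half counts
iterations.

For capped CG, `n + 1` nonzero orthogonal residuals cannot exist, so some test eventually fires. The
delicate case is slow decrease, where a suitable `i` must exist: if all the differences `y^{j+1} -
y^i` had curvature at least `ε`, an accelerated-gradient potential (`residual_sq_le`) would force
the residual below the threshold. This needs an upper bound for `H` along residuals only, which
explains the proviso in (b). -/

namespace LBNCG

/-! ### Conjugate gradients for an operator that may be indefinite -/

section ConjugateGradient

variable {F : Type*} [NormedAddCommGroup F] [InnerProductSpace ℝ F]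

/-- The conjugate gradient recursion for `A y = -g`. -/
structure IsCG (A : F →L[ℝ] F) (g : F) (y r p : ℕ → F) : Prop where
  y_zero : y 0 = 0
  r_zero : r 0 = g
  p_zero : p 0 = -g
  y_succ : ∀ j, y (j + 1) = y j + (inner ℝ (r j) (r j) / inner ℝ (p j) (A (p j))) • p j
  r_succ : ∀ j, r (j + 1) = r j + (inner ℝ (r j) (r j) / inner ℝ (p j) (A (p j))) • A (p j)
  p_succ : ∀ j, p (j + 1) = -r (j + 1) + (‖r (j + 1)‖ ^ 2 / ‖r j‖ ^ 2) • p j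

namespace IsCG

variable {A : F →L[ℝ] F} {g : F} {y r p : ℕ → F}

theorem residual_eq (h : IsCG A g y r p) (j : ℕ) : r j = A (y j) + g := by
  induction j with
  | zero => simp [h.y_zero, h.r_zero]
  | succ k ih => rw [h.r_succ, h.y_succ, map_add, map_smul, ih]; abel

theorem neg_r_eq (h : IsCG A g y r p) (j : ℕ) :
    r (j + 1) = -p (j + 1) + (‖r (j + 1)‖ ^ 2 / ‖r j‖ ^ 2) • p j := by
  rw [h.p_succ]; abel

/-- Orthogonality of the residuals and conjugacy of the directions. -/
theorem orthogonality (h : IsCG A g y r p) (hA : ∀ u v, inner ℝ (A u) v = inner ℝ u (A v))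
    (m : ℕ) (hr : ∀ i < m, r i ≠ 0) (hp : ∀ i < m, 0 < inner ℝ (p i) (A (p i))) :
    ∀ i ≤ m, (∀ k < i, inner ℝ (r i) (p k) = 0 ∧ inner ℝ (r i) (r k) = 0 ∧
      inner ℝ (p i) (A (p k)) = 0) ∧ inner ℝ (r i) (p i) = -‖r i‖ ^ 2 := by
  intro i
  induction i with
  | zero =>
    intro _
    refine ⟨fun k hk => absurd hk (by omega), ?_⟩
    rw [h.r_zero, h.p_zero, inner_neg_right, real_inner_self_eq_norm_sq]
  | succ i ih =>
    intro hi
    obtain ⟨ih1, ih2⟩ := ih (by omega)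
    have hpi := hp i (by omega)
    have hri : ‖r i‖ ^ 2 ≠ 0 := by
      have := norm_pos_iff.2 (hr i (by omega)); positivity
    have hrp : ∀ k ≤ i, inner ℝ (r (i + 1)) (p k) = 0 := by
      intro k hk
      rw [h.r_succ, inner_add_left, inner_smul_left, hA]
      rcases hk.lt_or_eq with hk | rfl
      · rw [(ih1 k hk).1, (ih1 k hk).2.2]; simp
      · rw [ih2, real_inner_self_eq_norm_sq]
        simp only [conj_trivial]
        rw [div_mul_cancel₀ _ hpi.ne']; ring
    have hrr : ∀ k ≤ i, inner ℝ (r (i + 1)) (r k) = 0 := by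
      intro k hk
      cases k with
      | zero =>
        have : r 0 = -p 0 := by rw [h.r_zero, h.p_zero, neg_neg]
        rw [this, inner_neg_right, hrp 0 hk, neg_zero]
      | succ k =>
        rw [h.neg_r_eq k, inner_add_right, inner_neg_right, inner_smul_right, hrp _ hk,
          hrp k (by omega)]
        simp
    refine ⟨fun k hk => ⟨hrp k (by omega), hrr k (by omega), ?_⟩, ?_⟩
    · have hpk := hp k (by omega)
      have hrk : ‖r k‖ ^ 2 ≠ 0 := by
        have := norm_pos_iff.2 (hr k (by omega)); positivity
      -- The recursion expresses `A (p k)` as a multiple of `r (k + 1) - r k`, so conjugacy reduces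
      -- to orthogonality of the residuals.
      have hAp : inner ℝ (r k) (r k) * inner ℝ (r (i + 1)) (A (p k)) =
          inner ℝ (p k) (A (p k)) * inner ℝ (r (i + 1)) (r (k + 1)) := by
        rw [h.r_succ k, inner_add_right, inner_smul_right, hrr k (by omega)]
        field_simp
        ring
      rw [real_inner_self_eq_norm_sq] at hAp
      rw [h.p_succ, inner_add_left, inner_neg_left, inner_smul_left]
      simp only [conj_trivial]
      rcases (Nat.lt_succ_iff.1 hk).lt_or_eq with hk | rfl
      · rw [hrr (k + 1) (by omega), mul_zero] at hAp
        rw [(mul_eq_zero.1 hAp).resolve_left hrk, (ih1 k hk).2.2]; simp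
      · rw [real_inner_self_eq_norm_sq] at hAp
        rw [neg_add_eq_zero, div_mul_eq_mul_div, eq_div_iff hri]
        linarith
    · rw [h.p_succ, inner_add_right, inner_neg_right, inner_smul_right, hrp i le_rfl,
        real_inner_self_eq_norm_sq]
      ring

/-- Each iterate `y k` is a combination of the directions with index below `k`. -/
theorem inner_residual_iterate (h : IsCG A g y r p) {i : ℕ}
    (hrp : ∀ k < i, inner ℝ (r i) (p k) = 0) : ∀ k ≤ i, inner ℝ (r i) (y k) = 0 := by
  intro k
  induction k with
  | zero => simp [h.y_zero]
  | succ k ih =>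
    intro hk
    rw [h.y_succ, inner_add_right, inner_smul_right, ih (by omega), hrp k (by omega)]
    simp

/-- The quadratic model minimised by conjugate gradients. -/
noncomputable def model (A : F →L[ℝ] F) (g z : F) : ℝ := inner ℝ z (A z) / 2 + inner ℝ g z

/-- The model is quadratic with gradient `A z + g`, so its second-order expansion is exact; at `z =
y i` this gradient is the residual. -/
theorem model_sub (hA : ∀ u v, inner ℝ (A u) v = inner ℝ u (A v)) (z w : F) :
    model A g w = model A g z + inner ℝ (A z + g) (w - z) +
      inner ℝ (w - z) (A (w - z)) / 2 := by
  have h1 : inner ℝ z (A w) = inner ℝ (A z) w := (hA z w).symm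
  have h2 : inner ℝ w (A z) = inner ℝ (A z) w := real_inner_comm _ _
  have h3 : inner ℝ (A z) z = inner ℝ z (A z) := real_inner_comm _ _
  simp only [model, map_sub, inner_sub_left, inner_sub_right, inner_add_left, h1, h2, h3]
  ring

/-- One step decreases the model at least as much as a gradient step of length `1 / L`. -/
theorem model_succ_le (h : IsCG A g y r p) (hA : ∀ u v, inner ℝ (A u) v = inner ℝ u (A v))
    {m : ℕ} (hr : ∀ i < m, r i ≠ 0) (hp : ∀ i < m, 0 < inner ℝ (p i) (A (p i)))
    {L : ℝ} {i : ℕ} (hi : i < m) (hrL : inner ℝ (r i) (A (r i)) ≤ L * ‖r i‖ ^ 2) :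
    ‖r i‖ ^ 2 ≤ 2 * L * (model A g (y i) - model A g (y (i + 1))) := by
  obtain ⟨ho, hrp⟩ := h.orthogonality hA m hr hp i hi.le
  have hpi := hp i hi
  have hri : 0 < ‖r i‖ ^ 2 := by
    have := norm_pos_iff.2 (hr i hi); positivity
  -- By conjugacy the curvature along `r` is that along `p` plus a nonnegative multiple of that
  -- along the previous direction.
  have hle : inner ℝ (p i) (A (p i)) ≤ inner ℝ (r i) (A (r i)) := by
    cases i with
    | zero => simp [h.p_zero, h.r_zero]
    | succ i =>
      have h1 : inner ℝ (p (i + 1)) (A (p i)) = 0 := (ho i (by omega)).2.2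
      have h2 : inner ℝ (p i) (A (p (i + 1))) = 0 := by
        rw [← hA, real_inner_comm, h1]
      set b := ‖r (i + 1)‖ ^ 2 / ‖r i‖ ^ 2 with hb
      have : inner ℝ (r (i + 1)) (A (r (i + 1))) = inner ℝ (p (i + 1)) (A (p (i + 1))) +
          b ^ 2 * inner ℝ (p i) (A (p i)) := by
        rw [h.neg_r_eq i, ← hb]
        simp only [map_add, map_neg, map_smul, inner_add_left, inner_add_right, inner_neg_left,
          inner_neg_right, inner_smul_left, inner_smul_right, h1, h2, conj_trivial]
        ring
      have h3 := hp i (by omega)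
      rw [this]
      nlinarith [sq_nonneg b, mul_nonneg (sq_nonneg b) h3.le]
  have hdec : model A g (y i) - model A g (y (i + 1)) =
      (‖r i‖ ^ 2) ^ 2 / (2 * inner ℝ (p i) (A (p i))) := by
    rw [model_sub hA (y i) (y (i + 1)), ← h.residual_eq, h.y_succ, add_sub_cancel_left, map_smul,
      inner_smul_left, inner_smul_right, inner_smul_right, hrp, real_inner_self_eq_norm_sq]
    simp only [conj_trivial]
    field_simp
    ring
  rw [hdec]
  have : inner ℝ (p i) (A (p i)) ≤ L * ‖r i‖ ^ 2 := hle.trans hrL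
  rw [mul_div_assoc', le_div_iff₀ (by positivity)]
  nlinarith [mul_le_mul_of_nonneg_left this hri.le]

/-- The auxiliary sequence of the accelerated convergence analysis. -/
noncomputable def anchor (y r : ℕ → F) (a ε : ℝ) : ℕ → F
  | 0 => 0
  | i + 1 => (1 - a) • anchor y r a ε i + a • (y i - ε⁻¹ • r i)

/-- Accelerated decrease of the residual as long as the curvature of `A` along the differences
of iterates is at least `ε`. -/
theorem residual_sq_le (h : IsCG A g y r p) (hA : ∀ u v, inner ℝ (A u) v = inner ℝ u (A v))
    {ε L : ℝ} (hε : 0 < ε) (hL : ε ≤ L) {j : ℕ} (hj : 0 < j)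
    (hr : ∀ i < j + 1, r i ≠ 0) (hp : ∀ i < j + 1, 0 < inner ℝ (p i) (A (p i)))
    (hrL : ∀ i ≤ j, inner ℝ (r i) (A (r i)) ≤ L * ‖r i‖ ^ 2)
    (hcurv : ∀ i < j,
      ε * ‖y (j + 1) - y i‖ ^ 2 ≤ inner ℝ (y (j + 1) - y i) (A (y (j + 1) - y i))) :
    ‖r j‖ ^ 2 ≤ 2 * (L / ε) * (1 - 1 / √(L / ε)) ^ j * ‖g‖ ^ 2 := by
  have hL0 : 0 < L := hε.trans_le hL
  have hκ : 1 ≤ L / ε := (one_le_div hε).2 hL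
  have hs1 : 1 ≤ √(L / ε) := Real.one_le_sqrt.2 hκ
  set a := 1 / √(L / ε) with ha
  have ha0 : 0 < a := by positivity
  have ha1 : a ≤ 1 := (div_le_one (by positivity)).2 hs1
  have ha2 : a ^ 2 = ε / L := by
    rw [ha, div_pow, Real.sq_sqrt (by positivity)]; field_simp
  have horth := h.orthogonality hA (j + 1) hr hp
  have hry : ∀ i ≤ j + 1, ∀ k ≤ i, inner ℝ (r i) (y k) = 0 := fun i hi =>
    h.inner_residual_iterate fun k hk => ((horth i hi).1 k hk).1
  set q := model A g
  set z := y (j + 1) with hz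
  set v := anchor y r a ε
  -- The anchor is built from earlier iterates and residuals, all orthogonal to the current
  -- residual. This replaces the coupling of sequences in an accelerated gradient method.
  have hrv : ∀ i ≤ j, ∀ k ≤ i, inner ℝ (r i) (v k) = 0 := by
    intro i hi k
    induction k with
    | zero => intro _; simp [v, anchor]
    | succ k ih =>
      intro hk
      simp only [v, anchor, inner_add_right, inner_smul_right, inner_sub_right]
      rw [hry i (by omega) k (by omega), ((horth i (by omega)).1 k (by omega)).2.1]
      have := ih (by omega)
      simp only [v] at this
      rw [this]; ring
  have hdec : ∀ i ≤ j, ‖r i‖ ^ 2 ≤ 2 * L * (q (y i) - q (y (i + 1))) := fun i hi =>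
    h.model_succ_le hA hr hp (by omega) (hrL i hi)
  -- Strong convexity is available only on the segments to the last iterate `z`, which therefore
  -- plays the role of the minimiser.
  have hsc : ∀ i < j, inner ℝ (r i) (y i - z) ≥ q (y i) - q z + ε / 2 * ‖y i - z‖ ^ 2 := by
    intro i hi
    have h1 := model_sub (g := g) hA (y i) z
    rw [← h.residual_eq] at h1
    have h2 := hcurv i hi
    rw [← neg_sub z (y i), inner_neg_right, norm_neg]
    change q z = q (y i) + _ + _ at h1
    linarith
  -- The potential contracts by `1 - a` with `a = √(ε / L)`: this `a` makes the squared residual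
  -- term in the anchor update equal to the model decrease guaranteed by `hdec`.
  have hV : ∀ i ≤ j, q (y i) - q z + ε / 2 * ‖v i - z‖ ^ 2 ≤
      (1 - a) ^ i * (q (y 0) - q z + ε / 2 * ‖v 0 - z‖ ^ 2) := by
    intro i
    induction i with
    | zero => intro _; simp
    | succ i ih =>
      intro hi
      have hi' : i < j := by omega
      have hstep : v (i + 1) - z =
          ((1 - a) • (v i - z) + a • (y i - z)) - (a / ε) • r i := by
        simp only [v, anchor]
        rw [div_eq_mul_inv, mul_smul]
        module
      have hn : ‖v (i + 1) - z‖ ^ 2 = ‖(1 - a) • (v i - z) + a • (y i - z)‖ ^ 2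
          - 2 * (a / ε) * inner ℝ (r i) (y i - z) + (a / ε) ^ 2 * ‖r i‖ ^ 2 := by
        rw [hstep, norm_sub_sq_real, inner_smul_right, norm_smul, real_inner_comm,
          inner_add_right, inner_smul_right, inner_smul_right, inner_sub_right, inner_sub_right,
          hrv i (by omega) i le_rfl, hry i (by omega) i le_rfl, mul_pow, Real.norm_eq_abs, sq_abs]
        ring
      have hc : ‖(1 - a) • (v i - z) + a • (y i - z)‖ ^ 2 ≤
          (1 - a) * ‖v i - z‖ ^ 2 + a * ‖y i - z‖ ^ 2 := by
        have h1 : ‖(1 - a) • (v i - z) + a • (y i - z)‖ ≤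
            (1 - a) * ‖v i - z‖ + a * ‖y i - z‖ := by
          refine (norm_add_le _ _).trans_eq ?_
          rw [norm_smul, norm_smul, Real.norm_of_nonneg (by linarith),
            Real.norm_of_nonneg ha0.le]
        refine (pow_le_pow_left₀ (norm_nonneg _) h1 2).trans ?_
        nlinarith [mul_nonneg (mul_nonneg ha0.le (sub_nonneg.2 ha1))
          (sq_nonneg (‖v i - z‖ - ‖y i - z‖))]
      have h1 := hdec i (by omega)
      have h2 := hsc i hi'
      have h3 : ε / 2 * ‖v (i + 1) - z‖ ^ 2 ≤ (1 - a) * (ε / 2 * ‖v i - z‖ ^ 2)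
          - a * (q (y i) - q z) + ‖r i‖ ^ 2 / (2 * L) := by
        have e1 : ε / 2 * (a / ε) ^ 2 = 1 / (2 * L) := by
          rw [div_pow, ha2]; field_simp
        have e2 : ε / 2 * (2 * (a / ε)) = a := by field_simp
        calc ε / 2 * ‖v (i + 1) - z‖ ^ 2
            = ε / 2 * ‖(1 - a) • (v i - z) + a • (y i - z)‖ ^ 2
              - (ε / 2 * (2 * (a / ε))) * inner ℝ (r i) (y i - z)
              + (ε / 2 * (a / ε) ^ 2) * ‖r i‖ ^ 2 := by rw [hn]; ring
          _ ≤ ε / 2 * ((1 - a) * ‖v i - z‖ ^ 2 + a * ‖y i - z‖ ^ 2)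
              - a * (q (y i) - q z + ε / 2 * ‖y i - z‖ ^ 2)
              + (1 / (2 * L)) * ‖r i‖ ^ 2 := by
                rw [e1, e2]
                have := mul_le_mul_of_nonneg_left hc (by positivity : 0 ≤ ε / 2)
                have := mul_le_mul_of_nonneg_left h2 ha0.le
                linarith
          _ = _ := by ring
      have h4 : ‖r i‖ ^ 2 / (2 * L) ≤ q (y i) - q (y (i + 1)) := by
        rw [div_le_iff₀ (by positivity)]; linarith
      calc _ ≤ (1 - a) * (q (y i) - q z + ε / 2 * ‖v i - z‖ ^ 2) := by linarith
        _ ≤ (1 - a) * ((1 - a) ^ i * (q (y 0) - q z + ε / 2 * ‖v 0 - z‖ ^ 2)) :=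
          mul_le_mul_of_nonneg_left (ih (by omega)) (by linarith)
        _ = _ := by ring
  -- Orthogonality of the last residual to `z` turns the curvature bound at `i = 0` into `ε ‖z‖ ≤
  -- ‖g‖`.
  have hV0 : q (y 0) - q z + ε / 2 * ‖v 0 - z‖ ^ 2 ≤ ‖g‖ ^ 2 / ε := by
    have h1 := hsc 0 hj
    have h2 := hcurv 0 hj
    have h3 := hry (j + 1) le_rfl (j + 1) le_rfl
    rw [h.residual_eq, inner_add_left, hA, ← hz] at h3
    rw [h.r_zero] at h1
    have hv0 : v 0 = y 0 := by simp [v, anchor, h.y_zero]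
    rw [hv0]
    rw [h.y_zero, sub_zero] at h2
    have h4 : inner ℝ g (y 0 - z) = -inner ℝ g z := by rw [h.y_zero]; simp
    have h5 : -inner ℝ g z ≤ ‖g‖ * ‖z‖ :=
      (neg_le_abs _).trans (abs_real_inner_le_norm g z)
    have h6 : ε * ‖z‖ ≤ ‖g‖ := by
      rcases (norm_nonneg z).eq_or_lt with h0 | h0
      · rw [← h0]; simp
      · nlinarith
    have h7 : ‖g‖ * ‖z‖ ≤ ‖g‖ ^ 2 / ε := by
      rw [le_div_iff₀ hε]; nlinarith [norm_nonneg g]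
    linarith
  have h1 := hdec j le_rfl
  have h2 := hV j le_rfl
  have h3 : (1 - a) ^ j * (q (y 0) - q z + ε / 2 * ‖v 0 - z‖ ^ 2) ≤
      (1 - a) ^ j * (‖g‖ ^ 2 / ε) :=
    mul_le_mul_of_nonneg_left hV0 (pow_nonneg (by linarith) _)
  have h4 : 0 ≤ ε / 2 * ‖v j - z‖ ^ 2 := by positivity
  calc ‖r j‖ ^ 2 ≤ 2 * L * (q (y j) - q z) := h1
    _ ≤ 2 * L * ((1 - a) ^ j * (‖g‖ ^ 2 / ε)) :=
      mul_le_mul_of_nonneg_left (by linarith) (by positivity)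
    _ = _ := by ring

end IsCG

end ConjugateGradient

end LBNCG

namespace LBNCG

/-! ### Termination and output of capped CG -/

section CappedConjugateGradient

variable {n : ℕ} {t : NormTests} {H : E n →L[ℝ] E n} {g : E n} {ε ζr c M : ℝ}

theorem isCG_cg (t : NormTests) (H : E n →L[ℝ] E n) (g : E n) (ε M : ℝ) :
    IsCG (damped H ε) g (fun j => (cg t H g ε M j).y) (fun j => (cg t H g ε M j).r)
      (fun j => (cg t H g ε M j).p) :=
  ⟨rfl, rfl, rfl, fun _ => rfl, fun _ => rfl, fun _ => rfl⟩

theorem damped_apply (H : E n →L[ℝ] E n) (ε : ℝ) (v : E n) :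
    damped H ε v = H v + (2 * ε) • v := by
  simp [damped]

theorem damped_symm (hH : ∀ u v, inner ℝ (H u) v = inner ℝ u (H v)) (ε : ℝ) (u v : E n) :
    inner ℝ (damped H ε u) v = inner ℝ u (damped H ε v) := by
  simp [damped_apply, inner_add_left, inner_add_right, inner_smul_left, inner_smul_right, hH]

theorem inner_damped (H : E n →L[ℝ] E n) (ε : ℝ) (v : E n) :
    inner ℝ v (damped H ε v) = inner ℝ v (H v) + 2 * ε * ‖v‖ ^ 2 := by
  rw [damped_apply, inner_add_right, inner_smul_right, real_inner_self_eq_norm_sq]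

theorem le_raise (H : E n →L[ℝ] E n) (M : ℝ) (v : E n) : M ≤ raise H M v := by
  unfold raise
  split_ifs with h
  · have hv : 0 < ‖v‖ := norm_pos_iff.2 fun hv => by simp [hv] at h
    exact ((lt_div_iff₀ hv).2 h).le
  · exact le_rfl

theorem norm_le_raise (H : E n →L[ℝ] E n) (M : ℝ) (v : E n) : ‖H v‖ ≤ raise H M v * ‖v‖ := by
  unfold raise
  split_ifs with h
  · have hv : 0 < ‖v‖ := norm_pos_iff.2 fun hv => by simp [hv] at h
    rw [div_mul_cancel₀ _ hv.ne']
  · exact not_lt.1 h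

theorem le_updateM (H : E n →L[ℝ] E n) (M : ℝ) (p y r : E n) (t : NormTests) :
    M ≤ updateM H M p y r t := by
  cases t with
  | chained =>
    have h1 := le_raise H M p
    have h2 := le_raise H M y
    have h3 := le_raise H M r
    simp only [raise] at h1 h2 h3
    simp only [updateM]
    split_ifs at * <;> assumption
  | consecutive => exact ((le_raise H M p).trans (le_raise H _ y)).trans (le_raise H _ r)

theorem monotone_cg_M (t : NormTests) (H : E n →L[ℝ] E n) (g : E n) (ε M : ℝ) :
    Monotone fun j => (cg t H g ε M j).M :=
  monotone_nat_of_le_succ fun _ => le_updateM _ _ _ _ _ _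

theorem le_cg_M (t : NormTests) (H : E n →L[ℝ] E n) (g : E n) (ε M : ℝ) (j : ℕ) :
    M ≤ (cg t H g ε M j).M :=
  (le_raise H M (-g)).trans (monotone_cg_M t H g ε M (Nat.zero_le j))

/-- The current value of `M` bounds `H` along all residuals computed so far. -/
theorem norm_apply_residual_le (h : t = .consecutive ∨ ‖H‖ ≤ M) {i j : ℕ} (hij : i ≤ j) :
    ‖H (cg t H g ε M i).r‖ ≤ (cg t H g ε M j).M * ‖(cg t H g ε M i).r‖ := by
  rcases h with rfl | h
  · refine le_trans ?_ (mul_le_mul_of_nonneg_right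
      (monotone_cg_M .consecutive H g ε M hij) (norm_nonneg _))
    cases i with
    | zero =>
      have := norm_le_raise H M (-g)
      rwa [map_neg, norm_neg, norm_neg] at this
    | succ i => exact norm_le_raise H _ _
  · exact (H.le_opNorm _).trans
      (mul_le_mul_of_nonneg_right (h.trans (le_cg_M t H g ε M j)) (norm_nonneg _))

theorem kappa_pos (hε : 0 < ε) (hM : 0 ≤ M) : 0 < kappa ε M := by
  unfold kappa; positivity

theorem one_le_kappa (hε : 0 < ε) (hM : 0 ≤ M) : 1 ≤ kappa ε M := by
  unfold kappa; rw [one_le_div hε]; linarith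

/-- A zero residual would pass both parts of the test. -/
theorem residual_ne_zero (hε : 0 < ε) (hζ : 0 ≤ ζr) (hc : 0 ≤ c) {s : CGState n} (hM : 0 ≤ s.M)
    (h : ¬ SmallResidual g ε ζr c s) : s.r ≠ 0 := by
  intro h0
  have := kappa_pos hε hM
  refine h ⟨?_, ?_⟩
  · rw [h0, norm_zero]; unfold zetaHat; positivity
  · simpa [h0, supNorm] using hc

/-- The standing properties of the main loop before termination. -/
theorem regular_of_continues (hH : ∀ u v, inner ℝ (H u) v = inner ℝ u (H v)) (hg : g ≠ 0)
    (hε : 0 < ε) (hζ : 0 ≤ ζr) (hc : 0 ≤ c) (hM : 0 ≤ M)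
    (h0 : ¬ LowCurv (damped H ε) ε (-g)) (j : ℕ)
    (hcont : ∀ i, 1 ≤ i → i < j → ¬ SmallResidual g ε ζr c (cg t H g ε M i) ∧
      ¬ LowCurv (damped H ε) ε (cg t H g ε M i).p) :
    (∀ i < j, (cg t H g ε M i).r ≠ 0) ∧
      ∀ i < j, 0 < inner ℝ (cg t H g ε M i).p (damped H ε (cg t H g ε M i).p) := by
  have hr : ∀ i < j, (cg t H g ε M i).r ≠ 0 := by
    intro i hi
    rcases Nat.eq_zero_or_pos i with rfl | hi'
    · exact hg
    · exact residual_ne_zero hε hζ hc (hM.trans (le_cg_M t H g ε M i)) (hcont i hi' hi).1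
  refine ⟨hr, ?_⟩
  intro i
  induction i using Nat.strong_induction_on with
  | _ i ih =>
    intro hi
    have horth := (isCG_cg t H g ε M).orthogonality (damped_symm hH ε) i
      (fun k hk => hr k (by omega)) (fun k hk => ih k hk (by omega)) i le_rfl
    -- A vanishing direction would make `⟨r, p⟩ = -‖r‖²` zero.
    have hp : (cg t H g ε M i).p ≠ 0 := by
      intro hp
      have h1 := horth.2
      simp only [hp, inner_zero_right] at h1
      have h2 := norm_pos_iff.2 (hr i hi)
      have h3 : (0 : ℝ) < ‖(cg t H g ε M i).r‖ ^ 2 := by positivity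
      linarith
    have hlow : ¬ LowCurv (damped H ε) ε (cg t H g ε M i).p := by
      rcases Nat.eq_zero_or_pos i with rfl | hi'
      · exact h0
      · exact (hcont i hi' hi).2
    have h1 := norm_pos_iff.2 hp
    exact lt_of_lt_of_le (by positivity) (not_lt.1 hlow)

theorem inner_damped_le (hMH : t = .consecutive ∨ ‖H‖ ≤ M) {i j : ℕ} (hij : i ≤ j) :
    inner ℝ (cg t H g ε M i).r (damped H ε (cg t H g ε M i).r) ≤
      ((cg t H g ε M j).M + 2 * ε) * ‖(cg t H g ε M i).r‖ ^ 2 := by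
  have h1 := norm_apply_residual_le (g := g) (ε := ε) hMH hij
  have h2 := real_inner_le_norm (cg t H g ε M i).r (H (cg t H g ε M i).r)
  rw [inner_damped]
  nlinarith [norm_nonneg (cg t H g ε M i).r]

/-- The constants of the slow-decrease test dominate the rate of conjugate gradients. -/
theorem rate_le (hε : 0 < ε) (hM : 0 ≤ M) (j : ℕ) :
    2 * kappa ε M * (1 - 1 / √(kappa ε M)) ^ j ≤
      (√(bigT ε M) * tau ε M ^ ((j : ℝ) / 2)) ^ 2 := by
  have hκ := one_le_kappa hε hM
  have hτ : tau ε M = 1 - 1 / (√(kappa ε M) + 1) := by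
    unfold tau; field_simp; ring
  unfold bigT
  set κ := kappa ε M
  set τ := tau ε M
  have hs : 1 ≤ √κ := Real.one_le_sqrt.2 hκ
  -- Here `τ = 1 - 1 / (√κ + 1)`, slightly slower than the CG rate `1 - 1 / √κ`; the prefactor `T`
  -- exceeds `2κ` generously.
  have h1 : 1 - 1 / √κ ≤ τ := by
    rw [hτ]
    have : 1 / (√κ + 1) ≤ 1 / √κ := one_div_le_one_div_of_le (by positivity) (by linarith)
    linarith
  have h2 : 0 ≤ 1 - 1 / √κ := sub_nonneg.2 ((div_le_one (by positivity)).2 hs)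
  have h3 : τ < 1 := by
    rw [hτ]
    have : 0 < 1 / (√κ + 1) := by positivity
    linarith
  have h4 : 0 < 1 - √τ := by
    have : √τ < 1 := by rw [Real.sqrt_lt' one_pos]; simpa using h3
    linarith
  have h5 : (1 - √τ) ^ 2 ≤ 1 := by
    have := Real.sqrt_nonneg τ
    nlinarith
  have h6 : 2 * κ ≤ 4 * κ ^ 4 / (1 - √τ) ^ 2 := by
    rw [le_div_iff₀ (by positivity)]
    have h7 : κ ≤ κ ^ 4 := le_self_pow₀ hκ (by norm_num)
    nlinarith
  have h8 : (τ ^ ((j : ℝ) / 2)) ^ 2 = τ ^ j := by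
    rw [← Real.rpow_natCast, ← Real.rpow_mul (h2.trans h1)]
    simp
  rw [mul_pow, Real.sq_sqrt (by positivity), h8]
  exact mul_le_mul h6 (pow_le_pow_left₀ h2 h1 j) (by positivity) (by positivity)

/-- Slow decrease of the residual reveals a direction of low curvature. -/
theorem exists_lowCurv_of_slowDecrease (hH : ∀ u v, inner ℝ (H u) v = inner ℝ u (H v))
    (hε : 0 < ε) (hM : 0 ≤ M) (hMH : t = .consecutive ∨ ‖H‖ ≤ M) {j : ℕ} (hj : 1 ≤ j)
    (hr : ∀ i < j + 1, (cg t H g ε M i).r ≠ 0)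
    (hp : ∀ i < j + 1, 0 < inner ℝ (cg t H g ε M i).p (damped H ε (cg t H g ε M i).p))
    (hslow : SlowDecrease g ε j (cg t H g ε M j)) :
    ∃ i < j, LowCurv (damped H ε) ε ((cg t H g ε M (j + 1)).y - (cg t H g ε M i).y) := by
  by_contra! hno
  have hMj := hM.trans (le_cg_M t H g ε M j)
  have h1 := (isCG_cg t H g ε M).residual_sq_le (damped_symm hH ε) hε
    (by linarith : ε ≤ (cg t H g ε M j).M + 2 * ε) hj hr hp
    (fun i hi => inner_damped_le hMH hi) (fun i hi => not_lt.1 (hno i hi))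
  have h2 := rate_le hε hMj j
  refine absurd hslow (not_lt.2 (abs_le_of_sq_le_sq' ?_ ?_).2)
  · refine h1.trans ?_
    rw [mul_pow]
    exact mul_le_mul_of_nonneg_right h2 (by positivity)
  · have hκ := one_le_kappa hε hMj
    unfold tau
    positivity

/-- If the loop never stopped, the residuals `r^0, …, r^n` would be `n + 1` nonzero orthogonal
vectors in dimension `n`. -/
theorem exists_not_continues (hH : ∀ u v, inner ℝ (H u) v = inner ℝ u (H v)) (hg : g ≠ 0)
    (hε : 0 < ε) (hζ : 0 ≤ ζr) (hc : 0 ≤ c) (hM : 0 ≤ M)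
    (h0 : ¬ LowCurv (damped H ε) ε (-g)) :
    ∃ j, 1 ≤ j ∧ ¬ Continues t H g ε ζr c M j := by
  by_contra! hcont
  obtain ⟨hr, hp⟩ := regular_of_continues (t := t) hH hg hε hζ hc hM h0 (n + 1)
    fun i hi _ => ⟨(hcont i hi).2.1, (hcont i hi).2.2.1⟩
  have horth := (isCG_cg t H g ε M).orthogonality (damped_symm hH ε) (n + 1) hr hp
  have hli : LinearIndependent ℝ fun i : Fin (n + 1) => (cg t H g ε M i).r := by
    refine linearIndependent_of_ne_zero_of_inner_eq_zero (fun i => hr i i.2) ?_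
    intro i k hik
    rcases lt_or_gt_of_ne (fun h => hik (Fin.ext h)) with h | h
    · rw [real_inner_comm]; exact ((horth k k.2.le).1 i h).2.1
    · exact ((horth i i.2.le).1 k h).2.1
  have := hli.fintype_card_le_finrank
  simp at this

/-- Capped CG terminates. -/
theorem exists_cappedCG (hH : ∀ u v, inner ℝ (H u) v = inner ℝ u (H v)) (hg : g ≠ 0)
    (hε : 0 < ε) (hζ : 0 ≤ ζr) (hc : 0 ≤ c) (hM : 0 ≤ M)
    (hMH : t = .consecutive ∨ ‖H‖ ≤ M) :
    ∃ flag d, CappedCG t H g ε ζr c M flag d := by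
  classical
  by_cases h0 : LowCurv (damped H ε) ε (-g)
  · exact ⟨_, _, .initial h0⟩
  have hex := exists_not_continues (t := t) hH hg hε hζ hc hM h0
  obtain ⟨hj, hnot⟩ := Nat.find_spec hex
  set j := Nat.find hex with hjdef
  have hcont : ∀ i, 1 ≤ i → i < j → Continues t H g ε ζr c M i := by
    intro i hi hij
    by_contra hno
    exact Nat.find_min hex hij ⟨hi, hno⟩
  suffices ∃ flag d, StopAt t H g ε ζr c M j flag d by
    obtain ⟨flag, d, hd⟩ := this
    exact ⟨flag, d, .loop h0 j hj hcont flag d hd⟩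
  by_cases h1 : LowCurv (damped H ε) ε (cg t H g ε M j).y
  · exact ⟨_, _, .y_curv h1⟩
  by_cases h2 : SmallResidual g ε ζr c (cg t H g ε M j)
  · exact ⟨_, _, .solved h1 h2⟩
  by_cases h3 : LowCurv (damped H ε) ε (cg t H g ε M j).p
  · exact ⟨_, _, .p_curv h1 h2 h3⟩
  have h4 : SlowDecrease g ε j (cg t H g ε M j) := by
    by_contra h4
    exact hnot ⟨h1, h2, h3, h4⟩
  -- The bound is `j + 1` because the slow-decrease rule computes `y^{j+1}`, hence uses `p^j`; at
  -- index `j` itself the failed tests supply what `Continues` gives earlier.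
  obtain ⟨hr, hp⟩ := regular_of_continues (t := t) hH hg hε hζ hc hM h0 (j + 1) (by
    intro i hi hij
    rcases (Nat.lt_succ_iff.1 hij).lt_or_eq with hij | rfl
    · exact ⟨(hcont i hi hij).2.1, (hcont i hi hij).2.2.1⟩
    · exact ⟨h2, h3⟩)
  obtain ⟨i, hi, h5⟩ := exists_lowCurv_of_slowDecrease hH hε hM hMH hj hr hp h4
  exact ⟨_, _, .slow h1 h2 h3 h4 i hi h5⟩

theorem CappedCG.lowCurv {v : E n} (h : CappedCG t H g ε ζr c M .nc v) :
    LowCurv (damped H ε) ε v := by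
  cases h with
  | initial h => exact h
  | loop h j hj hcont flag d hout =>
    cases hout with
    | y_curv h1 => exact h1
    | p_curv h1 h2 h3 => exact h3
    | slow h1 h2 h3 h4 i hi h5 => exact h5

/-- The properties of an approximate solution returned by capped CG. -/
theorem CappedCG.sol_spec (hH : ∀ u v, inner ℝ (H u) v = inner ℝ u (H v)) (hg : g ≠ 0)
    (hε : 0 < ε) (hζ : 0 ≤ ζr) (hc : 0 ≤ c) (hM : 0 ≤ M)
    {y : E n} (h : CappedCG t H g ε ζr c M .sol y) :
    ε * ‖y‖ ^ 2 ≤ inner ℝ y (damped H ε y) ∧ inner ℝ (damped H ε y + g) y = 0 ∧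
      supNorm (damped H ε y + g) ≤ c := by
  cases h with
  | loop h0 j hj hcont flag d hout =>
    cases hout with
    | solved h1 h2 =>
      obtain ⟨hr, hp⟩ := regular_of_continues (t := t) hH hg hε hζ hc hM h0 j
        fun i hi hij => ⟨(hcont i hi hij).2.1, (hcont i hi hij).2.2.1⟩
      have hcg := isCG_cg t H g ε M
      have horth := hcg.orthogonality (damped_symm hH ε) j hr hp j le_rfl
      have hres := hcg.residual_eq j
      have hin := hcg.inner_residual_iterate (fun k hk => (horth.1 k hk).1) j le_rfl
      rw [← hres]
      exact ⟨not_lt.1 h1, hin, h2.2⟩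

end CappedConjugateGradient

end LBNCG

namespace LBNCG

open Set Filter Topology

/-! ### Diagonal scalings and relative displacements -/

section Coordinates

variable {n : ℕ}

@[simp] theorem diag_apply (a v : E n) (i : Fin n) : diag a v i = a i * v i := by
  have : diag a v = WithLp.toLp 2 ((Matrix.diagonal a.ofLp).mulVec v.ofLp) := rfl
  rw [this]
  simp [Matrix.mulVec_diagonal]

@[simp] theorem capped_apply (x : E n) (i : Fin n) : capped x i = min (x i) 1 := rfl

@[simp] theorem inverseDiag_apply (x v : E n) (i : Fin n) :
    inverseDiag x v i = (x i)⁻¹ * v i := by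
  simp [inverseDiag]

theorem inner_eq_sum (u v : E n) : inner ℝ u v = ∑ i, u i * v i := by
  rw [PiLp.inner_apply]
  exact Finset.sum_congr rfl fun i _ => by simp [mul_comm]

theorem inner_diag_left (a u v : E n) : inner ℝ (diag a u) v = inner ℝ u (diag a v) := by
  simp only [inner_eq_sum, diag_apply]
  exact Finset.sum_congr rfl fun i _ => by ring

theorem abs_apply_le_supNorm (v : E n) (i : Fin n) : |v i| ≤ supNorm v :=
  norm_le_pi_norm v.ofLp i

theorem supNorm_nonneg (v : E n) : 0 ≤ supNorm v := norm_nonneg _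

theorem supNorm_le_iff {v : E n} {c : ℝ} (hc : 0 ≤ c) : supNorm v ≤ c ↔ ∀ i, |v i| ≤ c :=
  pi_norm_le_iff_of_nonneg hc

theorem supNorm_smul (c : ℝ) (v : E n) : supNorm (c • v) = |c| * supNorm v := by
  simp [supNorm, norm_smul]

theorem abs_apply_le_norm (v : E n) (i : Fin n) : |v i| ≤ ‖v‖ :=
  PiLp.norm_apply_le v i

theorem norm_diag_le {a : E n} (ha : ∀ i, |a i| ≤ 1) (v : E n) : ‖diag a v‖ ≤ ‖v‖ := by
  rw [EuclideanSpace.norm_eq, EuclideanSpace.norm_eq]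
  refine Real.sqrt_le_sqrt (Finset.sum_le_sum fun i _ => ?_)
  simp only [diag_apply, Real.norm_eq_abs, sq_abs, mul_pow]
  have : a i ^ 2 ≤ 1 := by rw [← sq_abs]; exact pow_le_one₀ (abs_nonneg _) (ha i)
  nlinarith [sq_nonneg (v i)]

theorem capped_pos {x : E n} (hx : ∀ i, 0 < x i) (i : Fin n) : 0 < capped x i := by
  simp [hx i]

theorem abs_capped_le {x : E n} (hx : ∀ i, 0 < x i) (i : Fin n) : |capped x i| ≤ 1 := by
  rw [abs_of_pos (capped_pos hx i)]; simp

theorem norm_diag_capped_le {x : E n} (hx : ∀ i, 0 < x i) (v : E n) :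
    ‖diag (capped x) v‖ ≤ ‖v‖ := norm_diag_le (abs_capped_le hx) v

/-- `X⁻¹ X̄ v`, the relative displacement. -/
noncomputable def relative (x v : E n) : E n := inverseDiag x (diag (capped x) v)

theorem relative_apply (x v : E n) (i : Fin n) : relative x v i = (x i)⁻¹ * (min (x i) 1 * v i) := by
  simp [relative]

theorem ratio_mem {x : E n} (hx : ∀ i, 0 < x i) (i : Fin n) :
    0 < (x i)⁻¹ * min (x i) 1 ∧ (x i)⁻¹ * min (x i) 1 ≤ 1 := by
  have h := hx i
  refine ⟨by positivity, ?_⟩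
  rw [inv_mul_le_one₀ h]; exact min_le_left _ _

theorem abs_relative_le {x : E n} (hx : ∀ i, 0 < x i) (v : E n) (i : Fin n) :
    |relative x v i| ≤ |v i| := by
  obtain ⟨h1, h2⟩ := ratio_mem hx i
  rw [relative_apply, ← mul_assoc, abs_mul, abs_of_pos h1]
  exact mul_le_of_le_one_left (abs_nonneg _) h2

theorem mul_relative {x : E n} (hx : ∀ i, 0 < x i) (v : E n) (i : Fin n) :
    x i * relative x v i = min (x i) 1 * v i := by
  have := (hx i).ne'
  rw [relative_apply]; field_simp

/-- A step multiplies each coordinate by `1 + s · relative`, so a bound `β < 1` on the relative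
displacement keeps it positive and separates the logarithms. -/
theorem step_apply {x : E n} (hx : ∀ i, 0 < x i) (s : ℝ) (v : E n) (i : Fin n) :
    (x + s • diag (capped x) v) i = x i * (1 + s * relative x v i) := by
  have := mul_relative hx v i
  simp only [PiLp.add_apply, PiLp.smul_apply, diag_apply, capped_apply, smul_eq_mul]
  linear_combination -s * this

theorem step_pos {x : E n} (hx : ∀ i, 0 < x i) {v : E n} {β : ℝ} (hβ : β < 1)
    (hv : supNorm (relative x v) ≤ β) {s : ℝ} (h0 : 0 ≤ s) (h1 : s ≤ 1) (i : Fin n) :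
    0 < (x + s • diag (capped x) v) i := by
  rw [step_apply hx]
  refine mul_pos (hx i) ?_
  have hs : |s * relative x v i| ≤ β := by
    rw [abs_mul, abs_of_nonneg h0]
    exact (mul_le_of_le_one_left (abs_nonneg _) h1).trans ((abs_apply_le_supNorm _ i).trans hv)
  have := (abs_le.1 hs).1
  linarith

theorem supNorm_relative_pos {x : E n} (hx : ∀ i, 0 < x i) {v : E n} (hv : v ≠ 0) :
    0 < supNorm (relative x v) := by
  obtain ⟨i, hi⟩ : ∃ i, v i ≠ 0 := by
    by_contra! h
    exact hv (by ext i; exact h i)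
  refine lt_of_lt_of_le ?_ (abs_apply_le_supNorm _ i)
  have := (ratio_mem hx i).1
  rw [relative_apply, ← mul_assoc]
  exact abs_pos.2 (mul_ne_zero this.ne' hi)

theorem supNorm_relative_le_norm {x : E n} (hx : ∀ i, 0 < x i) (v : E n) :
    supNorm (relative x v) ≤ ‖v‖ :=
  (supNorm_le_iff (norm_nonneg _)).2 fun i =>
    (abs_relative_le hx v i).trans (abs_apply_le_norm v i)

end Coordinates

/-! ### Taylor estimates under a Lipschitz Hessian -/

section Taylor

variable {n : ℕ} {f : E n → ℝ} {LH : ℝ} {U : Set (E n)}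

/-- The inverse Riesz map of `ℝⁿ` as a real linear map. -/
noncomputable def riesz (n : ℕ) : (E n →L[ℝ] ℝ) →L[ℝ] E n :=
  LinearMap.toContinuousLinearMap
    { toFun := fun l => (InnerProductSpace.toDual ℝ (E n)).symm l
      map_add' := fun a b => map_add _ a b
      map_smul' := fun c a => by simp }

theorem inner_riesz (l : E n →L[ℝ] ℝ) (v : E n) : inner ℝ (riesz n l) v = l v :=
  InnerProductSpace.toDual_symm_apply

theorem hasFDerivAt_gradient {x : E n} (hf : ContDiffAt ℝ 2 f x) :
    HasFDerivAt (gradient f) ((riesz n).comp (fderiv ℝ (fderiv ℝ f) x)) x := by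
  have h : DifferentiableAt ℝ (fderiv ℝ f) x :=
    (hf.fderiv_right (m := 1) (by norm_num)).differentiableAt (by norm_num)
  exact (riesz n).hasFDerivAt.comp x h.hasFDerivAt

theorem hess_eq {x : E n} (hf : ContDiffAt ℝ 2 f x) :
    hess f x = (riesz n).comp (fderiv ℝ (fderiv ℝ f) x) := (hasFDerivAt_gradient hf).fderiv

theorem hasFDerivAt_gradient_hess {x : E n} (hf : ContDiffAt ℝ 2 f x) :
    HasFDerivAt (gradient f) (hess f x) x := by
  rw [hess_eq hf]; exact hasFDerivAt_gradient hf

theorem hess_symm {x : E n} (hf : ContDiffAt ℝ 2 f x) (u v : E n) :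
    inner ℝ (hess f x u) v = inner ℝ u (hess f x v) := by
  rw [real_inner_comm (hess f x v) u, hess_eq hf]
  simp only [ContinuousLinearMap.comp_apply, inner_riesz]
  exact (hf.isSymmSndFDerivAt (by simp)).eq u v

theorem LipschitzHessianOn.contDiffAt (h : LipschitzHessianOn f LH U) {x : E n} (hx : x ∈ U) :
    ContDiffAt ℝ 2 f x := h.2.1.contDiffAt (h.1.mem_nhds hx)

theorem hasDerivAt_line (x w : E n) (s : ℝ) : HasDerivAt (fun s : ℝ => x + s • w) w s := by
  simpa using ((hasDerivAt_id s).smul_const w).const_add x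

theorem line_mem {x w : E n} (hseg : segment ℝ x (x + w) ⊆ U) {s : ℝ} (hs : s ∈ Icc (0 : ℝ) 1) :
    x + s • w ∈ U := by
  apply hseg
  rw [segment_eq_image']
  exact ⟨s, hs, by simp⟩

/-- Second-order Taylor estimate for the gradient. -/
theorem norm_gradient_sub_le (h : LipschitzHessianOn f LH U) {x w : E n}
    (hseg : segment ℝ x (x + w) ⊆ U) {s : ℝ} (hs : s ∈ Icc (0 : ℝ) 1) :
    ‖gradient f (x + s • w) - gradient f x - s • hess f x w‖ ≤ LH / 2 * ‖w‖ ^ 2 * s ^ 2 := by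
  have hd : ∀ s ∈ Icc (0 : ℝ) 1, HasDerivAt
      (fun s : ℝ => gradient f (x + s • w) - gradient f x - s • hess f x w)
      (hess f (x + s • w) w - hess f x w) s := by
    intro s hs
    have h1 := (hasFDerivAt_gradient_hess (h.contDiffAt (line_mem hseg hs))).comp_hasDerivAt s
      (hasDerivAt_line x w s)
    have h2 := (hasDerivAt_id s).smul_const (hess f x w)
    exact ((h1.sub_const (gradient f x)).fun_sub h2).congr_deriv (by simp)
  refine image_norm_le_of_norm_deriv_right_le_deriv_boundary
    (f' := fun s => hess f (x + s • w) w - hess f x w)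
    (B := fun s => LH / 2 * ‖w‖ ^ 2 * s ^ 2) (B' := fun s => LH * ‖w‖ ^ 2 * s)
    (fun s hs => (hd s hs).continuousAt.continuousWithinAt)
    (fun s hs => (hd s (Ico_subset_Icc_self hs)).hasDerivWithinAt) (by simp) ?_ ?_ hs
  · intro s
    refine (((hasDerivAt_id s).pow 2).const_mul (LH / 2 * ‖w‖ ^ 2)).congr_deriv ?_
    simp; ring
  · intro s hs
    have h1 := h.2.2 _ (line_mem hseg (Ico_subset_Icc_self hs)) _
      (by simpa using line_mem hseg (left_mem_Icc.2 zero_le_one))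
    rw [add_sub_cancel_left, norm_smul, Real.norm_of_nonneg hs.1] at h1
    calc ‖hess f (x + s • w) w - hess f x w‖ = ‖(hess f (x + s • w) - hess f x) w‖ := by simp
      _ ≤ ‖hess f (x + s • w) - hess f x‖ * ‖w‖ := ContinuousLinearMap.le_opNorm _ _
      _ ≤ LH * (s * ‖w‖) * ‖w‖ := by gcongr
      _ = LH * ‖w‖ ^ 2 * s := by ring

/-- Third-order Taylor estimate for the function. -/
theorem abs_sub_taylor_le (h : LipschitzHessianOn f LH U) {x w : E n}
    (hseg : segment ℝ x (x + w) ⊆ U) {s : ℝ} (hs : s ∈ Icc (0 : ℝ) 1) :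
    |f (x + s • w) - f x - s * inner ℝ (gradient f x) w - s ^ 2 / 2 * inner ℝ w (hess f x w)| ≤
      LH / 6 * ‖w‖ ^ 3 * s ^ 3 := by
  have hd : ∀ s ∈ Icc (0 : ℝ) 1, HasDerivAt
      (fun s : ℝ => f (x + s • w) - f x - s * inner ℝ (gradient f x) w
        - s ^ 2 / 2 * inner ℝ w (hess f x w))
      (inner ℝ (gradient f (x + s • w) - gradient f x - s • hess f x w) w) s := by
    intro s hs
    have hdf := (h.contDiffAt (line_mem hseg hs)).differentiableAt (by norm_num)
    have h1 := hdf.hasFDerivAt.comp_hasDerivAt s (hasDerivAt_line x w s)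
    rw [← inner_gradient_left] at h1
    have h2 := (hasDerivAt_id s).mul_const (inner ℝ (gradient f x) w)
    have h3 := (((hasDerivAt_id s).pow 2).div_const 2).mul_const (inner ℝ w (hess f x w))
    refine (((h1.sub_const (f x)).fun_sub h2).fun_sub h3).congr_deriv ?_
    rw [real_inner_comm (hess f x w) w]
    simp only [inner_sub_left, inner_smul_left, conj_trivial, id]
    norm_num
  refine image_norm_le_of_norm_deriv_right_le_deriv_boundary
    (f' := fun s => inner ℝ (gradient f (x + s • w) - gradient f x - s • hess f x w) w)
    (B := fun s => LH / 6 * ‖w‖ ^ 3 * s ^ 3) (B' := fun s => LH / 2 * ‖w‖ ^ 3 * s ^ 2)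
    (fun s hs => (hd s hs).continuousAt.continuousWithinAt)
    (fun s hs => (hd s (Ico_subset_Icc_self hs)).hasDerivWithinAt) (by simp) ?_ ?_ hs
  · intro s
    refine (((hasDerivAt_id s).pow 3).const_mul (LH / 6 * ‖w‖ ^ 3)).congr_deriv ?_
    simp; ring
  · intro s hs
    calc _ ≤ ‖gradient f (x + s • w) - gradient f x - s • hess f x w‖ * ‖w‖ :=
          norm_inner_le_norm _ _
      _ ≤ LH / 2 * ‖w‖ ^ 2 * s ^ 2 * ‖w‖ := mul_le_mul_of_nonneg_right
          (norm_gradient_sub_le h hseg (Ico_subset_Icc_self hs)) (norm_nonneg _)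
      _ = LH / 2 * ‖w‖ ^ 3 * s ^ 2 := by ring

end Taylor

/-! ### Derivatives and cubic upper model of the barrier function -/

section Barrier

variable {n : ℕ} {f : E n → ℝ} {LH : ℝ} {U : Set (E n)}

/-- The vector of reciprocals. -/
noncomputable def recip (x : E n) : E n := WithLp.toLp 2 fun i => (x i)⁻¹

@[simp] theorem recip_apply (x : E n) (i : Fin n) : recip x i = (x i)⁻¹ := rfl

theorem hasFDerivAt_coord (x : E n) (i : Fin n) :
    HasFDerivAt (fun x : E n => x i) (EuclideanSpace.proj i : E n →L[ℝ] ℝ) x :=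
  (EuclideanSpace.proj i : E n →L[ℝ] ℝ).hasFDerivAt

theorem hasGradientAt_barrier {μ : ℝ} {x : E n} (hf : DifferentiableAt ℝ f x)
    (hx : ∀ i, 0 < x i) :
    HasGradientAt (barrier f μ) (gradient f x - μ • recip x) x := by
  rw [hasGradientAt_iff_hasFDerivAt]
  have h1 : HasFDerivAt (fun x : E n => ∑ i, Real.log (x i))
      (∑ i, (x i)⁻¹ • (EuclideanSpace.proj i : E n →L[ℝ] ℝ)) x :=
    HasFDerivAt.fun_sum fun i _ => (hasFDerivAt_coord x i).log (hx i).ne'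
  have h2 := hf.hasFDerivAt.sub (h1.const_mul μ)
  refine h2.congr_fderiv ?_
  ext v
  simp only [sub_apply, smul_apply,
    sum_apply, InnerProductSpace.toDual_apply_apply, inner_sub_left,
    inner_smul_left, inner_gradient_left, conj_trivial, smul_eq_mul]
  rw [inner_eq_sum]
  simp

theorem hasFDerivAt_recip {x : E n} (hx : ∀ i, 0 < x i) :
    HasFDerivAt recip (-(diag (WithLp.toLp 2 fun i => (x i ^ 2)⁻¹))) x := by
  rw [← hasFDerivWithinAt_univ, hasFDerivWithinAt_euclidean]
  intro i
  rw [hasFDerivWithinAt_univ]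
  have := (hasDerivAt_inv (hx i).ne').comp_hasFDerivAt x (hasFDerivAt_coord x i)
  refine this.congr_fderiv ?_
  ext v
  simp

theorem isOpen_orthant : IsOpen {x : E n | ∀ i, 0 < x i} := by
  simp only [ofPred_forall]
  exact isOpen_iInter_of_finite fun i =>
    isOpen_lt continuous_const (EuclideanSpace.proj i : E n →L[ℝ] ℝ).continuous

theorem gradient_barrier {μ : ℝ} {x : E n} (hf : ContDiffAt ℝ 2 f x) (hx : ∀ i, 0 < x i) :
    gradient (barrier f μ) x = gradient f x - μ • recip x :=
  (hasGradientAt_barrier (hf.differentiableAt (by norm_num)) hx).gradient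

theorem hess_barrier {μ : ℝ} {x : E n} (hf : ContDiffAt ℝ 2 f x) (hx : ∀ i, 0 < x i) :
    hess (barrier f μ) x = hess f x + μ • diag (WithLp.toLp 2 fun i => (x i ^ 2)⁻¹) := by
  have h1 := (hasFDerivAt_gradient_hess hf).sub ((hasFDerivAt_recip hx).const_smul μ)
  -- Differentiating the gradient needs its formula near `x`, not only at `x`.
  have h2 : gradient (barrier f μ) =ᶠ[𝓝 x] fun y => gradient f y - μ • recip y := by
    filter_upwards [hf.eventually (by simp), isOpen_orthant.mem_nhds hx] with y hy hy'
    exact gradient_barrier hy hy'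
  have h3 := (h1.congr_of_eventuallyEq h2).fderiv
  rw [hess, h3]
  simp

theorem sGrad_apply (P : Params) {x : E n} (hf : ContDiffAt ℝ 2 f x) (hx : ∀ i, 0 < x i)
    (i : Fin n) :
    sGrad P f x i = min (x i) 1 * gradient f x i - P.μ * ((x i)⁻¹ * min (x i) 1) := by
  simp only [sGrad, gradient_barrier hf hx, diag_apply, capped_apply, PiLp.sub_apply,
    PiLp.smul_apply, recip_apply, smul_eq_mul]
  ring

theorem sHess_apply (P : Params) {x : E n} (hf : ContDiffAt ℝ 2 f x) (hx : ∀ i, 0 < x i)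
    (v : E n) (i : Fin n) :
    sHess P f x v i = min (x i) 1 * hess f x (diag (capped x) v) i +
      P.μ * ((x i)⁻¹ * min (x i) 1) * relative x v i := by
  simp only [sHess, scaled, hess_barrier hf hx, ContinuousLinearMap.comp_apply,
    add_apply, smul_apply, diag_apply, capped_apply,
    PiLp.add_apply, PiLp.smul_apply, smul_eq_mul, relative_apply]
  ring

theorem sHess_symm (P : Params) {x : E n} (hf : ContDiffAt ℝ 2 f x) (hx : ∀ i, 0 < x i)
    (u v : E n) : inner ℝ (sHess P f x u) v = inner ℝ u (sHess P f x v) := by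
  simp only [sHess, scaled, hess_barrier hf hx, ContinuousLinearMap.comp_apply,
    add_apply, smul_apply, inner_diag_left,
    inner_add_left, inner_add_right, inner_smul_left, inner_smul_right, map_add, map_smul,
    conj_trivial]
  rw [hess_symm hf, inner_diag_left]

/-- The barrier contributes `μ` times the square of `X⁻¹ X̄`, whose entries lie in `(0, 1]`. This is
why `M_μ` adds just `μ` to the bound on the Hessian of `f`. -/
theorem norm_sHess_le (P : Params) (hμ : 0 ≤ P.μ) {x : E n} (hf : ContDiffAt ℝ 2 f x)
    (hx : ∀ i, 0 < x i) : ‖sHess P f x‖ ≤ ‖hess f x‖ + P.μ := by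
  refine ContinuousLinearMap.opNorm_le_bound _ (by positivity) fun v => ?_
  have h : sHess P f x v = diag (capped x) (hess f x (diag (capped x) v)) +
      P.μ • diag (WithLp.toLp 2 fun i => (x i)⁻¹ * min (x i) 1)
        (diag (WithLp.toLp 2 fun i => (x i)⁻¹ * min (x i) 1) v) := by
    ext i
    rw [sHess_apply P hf hx]
    simp [relative_apply]
    ring
  have hr : ∀ i, |(WithLp.toLp 2 fun i => (x i)⁻¹ * min (x i) 1 : E n) i| ≤ 1 := by
    intro i
    obtain ⟨h1, h2⟩ := ratio_mem hx i
    exact (abs_of_pos h1).trans_le h2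
  have h1 : ‖diag (capped x) (hess f x (diag (capped x) v))‖ ≤ ‖hess f x‖ * ‖v‖ :=
    (norm_diag_capped_le hx _).trans ((ContinuousLinearMap.le_opNorm _ _).trans
      (mul_le_mul_of_nonneg_left (norm_diag_capped_le hx _) (norm_nonneg _)))
  have h2 := (norm_diag_le hr (diag (WithLp.toLp 2 fun i => (x i)⁻¹ * min (x i) 1) v)).trans
    (norm_diag_le hr v)
  rw [h]
  refine (norm_add_le _ _).trans ?_
  rw [norm_smul, Real.norm_of_nonneg hμ, add_mul]
  exact add_le_add h1 (mul_le_mul_of_nonneg_left h2 hμ)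

theorem inner_sGrad (P : Params) {x : E n} (hf : ContDiffAt ℝ 2 f x) (hx : ∀ i, 0 < x i)
    (v : E n) : inner ℝ (sGrad P f x) v =
      inner ℝ (gradient f x) (diag (capped x) v) - P.μ * ∑ i, relative x v i := by
  simp only [inner_eq_sum, sGrad_apply P hf hx, relative_apply, diag_apply, capped_apply,
    Finset.mul_sum, ← Finset.sum_sub_distrib]
  exact Finset.sum_congr rfl fun i _ => by ring

theorem inner_sHess (P : Params) {x : E n} (hf : ContDiffAt ℝ 2 f x) (hx : ∀ i, 0 < x i)
    (v : E n) : inner ℝ v (sHess P f x v) =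
      inner ℝ (diag (capped x) v) (hess f x (diag (capped x) v)) +
        P.μ * ∑ i, relative x v i ^ 2 := by
  simp only [inner_eq_sum, sHess_apply P hf hx, relative_apply, diag_apply, capped_apply,
    Finset.mul_sum, ← Finset.sum_add_distrib]
  exact Finset.sum_congr rfl fun i _ => by ring

/-- This is the Taylor series of the logarithm cut after two terms, with its geometric tail bound.
-/
theorem neg_log_one_add_le {s β : ℝ} (hβ : β < 1) (hs : |s| ≤ β) :
    -Real.log (1 + s) ≤ -s + s ^ 2 / 2 + |s| ^ 3 / (1 - β) := by
  have h := Real.abs_log_sub_add_sum_range_le (x := -s) (by rw [abs_neg]; linarith) 2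
  simp only [Finset.sum_range_succ, Finset.sum_range_zero, abs_neg, sub_neg_eq_add] at h
  norm_num at h
  have h1 : |s| ^ 3 / (1 - |s|) ≤ |s| ^ 3 / (1 - β) := by
    gcongr
  have h2 := (abs_le.1 h).1
  linarith

theorem sum_abs_cube_le (v : E n) : ∑ i, |v i| ^ 3 ≤ ‖v‖ ^ 3 := by
  have h : ‖v‖ ^ 3 = ∑ i, ‖v‖ * v i ^ 2 := by
    rw [← Finset.mul_sum, ← EuclideanSpace.real_norm_sq_eq]; ring
  rw [h]
  refine Finset.sum_le_sum fun i _ => ?_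
  rw [pow_succ', sq_abs]
  exact mul_le_mul_of_nonneg_right (abs_apply_le_norm v i) (sq_nonneg _)

/-- Cubic upper model of the barrier function along a scaled step. -/
theorem barrier_step_le {P : Params} (hP : P.Valid) (hLH : 0 < LH)
    (h : LipschitzHessianOn f LH U) {x d : E n} (hx : ∀ i, 0 < x i) (hseg : trialPath x d ⊆ U)
    (hd : supNorm (relative x d) ≤ P.β) {s : ℝ} (hs : s ∈ Icc (0 : ℝ) 1) :
    barrier f P.μ (x + s • diag (capped x) d) ≤ barrier f P.μ x
      + s * inner ℝ (sGrad P f x) d + s ^ 2 / 2 * inner ℝ d (sHess P f x d)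
      + s ^ 3 / 6 * (LH + (2 - P.β) / (1 - P.β) ^ 2) * ‖d‖ ^ 3 := by
  have hxU : x ∈ U := hseg (left_mem_segment ℝ _ _)
  have hf := h.contDiffAt hxU
  have hβ := hP.β_lt
  have hμ : 0 < P.μ := by have := hP.εg_pos; unfold Params.μ; positivity
  have hμ' : P.μ < 1 / 4 := by have := hP.εg_lt; unfold Params.μ; linarith
  have h1 := (abs_le.1 (abs_sub_taylor_le h hseg hs)).2
  have hw := norm_diag_capped_le hx d
  have h2 : LH / 6 * ‖diag (capped x) d‖ ^ 3 * s ^ 3 ≤ LH / 6 * ‖d‖ ^ 3 * s ^ 3 := by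
    have := hs.1
    gcongr
  have hlog : ∀ i, -Real.log ((x + s • diag (capped x) d) i) ≤ -Real.log (x i)
      - s * relative x d i + s ^ 2 / 2 * relative x d i ^ 2
      + s ^ 3 / (1 - P.β) * |d i| ^ 3 := by
    intro i
    have hr := (abs_apply_le_supNorm _ i).trans hd
    have hsr : |s * relative x d i| ≤ P.β := by
      rw [abs_mul, abs_of_nonneg hs.1]
      exact (mul_le_of_le_one_left (abs_nonneg _) hs.2).trans hr
    have h0 : 0 < 1 + s * relative x d i := by
      have := (abs_le.1 hsr).1
      linarith
    rw [step_apply hx, Real.log_mul (hx i).ne' h0.ne']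
    have h3 := neg_log_one_add_le hβ hsr
    have h4 : |s * relative x d i| ^ 3 / (1 - P.β) ≤ s ^ 3 / (1 - P.β) * |d i| ^ 3 := by
      rw [abs_mul, abs_of_nonneg hs.1, mul_pow, div_mul_eq_mul_div]
      have h5 := abs_relative_le hx d i
      have := hs.1
      have : 0 < 1 - P.β := by linarith
      gcongr
    linarith
  have hsum : -∑ i, Real.log ((x + s • diag (capped x) d) i) ≤ -∑ i, Real.log (x i)
      - s * ∑ i, relative x d i + s ^ 2 / 2 * ∑ i, relative x d i ^ 2
      + s ^ 3 / (1 - P.β) * ‖d‖ ^ 3 := by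
    have h3 := Finset.sum_le_sum fun i (_ : i ∈ Finset.univ) => hlog i
    simp only [Finset.sum_add_distrib, Finset.sum_sub_distrib, Finset.sum_neg_distrib,
      ← Finset.mul_sum] at h3
    refine h3.trans ?_
    have : 0 ≤ s ^ 3 / (1 - P.β) := div_nonneg (pow_nonneg hs.1 3) (by linarith)
    have := mul_le_mul_of_nonneg_left (sum_abs_cube_le d) this
    linarith
  -- Since `μ < 1/4`, the factor `6 μ (1 - β)` is below `2 - β`, so the logarithmic remainder fits
  -- the coefficient appearing in the constants.
  have hcoef : P.μ * (s ^ 3 / (1 - P.β)) ≤ s ^ 3 / 6 * ((2 - P.β) / (1 - P.β) ^ 2) := by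
    have hb : 0 < 1 - P.β := by linarith
    have hb' : 1 - P.β ≤ 1 := by have := Real.sqrt_nonneg P.εg; linarith [hP.β_ge]
    have h3 : P.μ / (1 - P.β) ≤ (2 - P.β) / (1 - P.β) ^ 2 / 6 := by
      rw [div_div, div_le_div_iff₀ hb (by positivity)]
      have : P.μ * (6 * (1 - P.β)) ≤ 2 - P.β := by nlinarith
      nlinarith
    have := mul_le_mul_of_nonneg_left h3 (pow_nonneg hs.1 3)
    calc _ = s ^ 3 * (P.μ / (1 - P.β)) := by ring
      _ ≤ _ := this
      _ = _ := by ring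
  have h3 := mul_le_mul_of_nonneg_left hsum hμ.le
  have h4 := mul_le_mul_of_nonneg_right hcoef (by positivity : 0 ≤ ‖d‖ ^ 3)
  rw [inner_sGrad P hf hx, inner_sHess P hf hx]
  unfold barrier
  nlinarith [h1, h2, h3, h4]

end Barrier

end LBNCG

namespace LBNCG

open Set Filter Topology

/-! ### The constants -/

section Parameters

variable {P : Params}

theorem Params.Valid.εH_pos (hP : P.Valid) : 0 < P.εH := Real.sqrt_pos.2 hP.εg_pos

theorem Params.Valid.εH_sq (hP : P.Valid) : P.εH ^ 2 = P.εg := Real.sq_sqrt hP.εg_pos.le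

theorem Params.Valid.εH_lt (hP : P.Valid) : P.εH < 1 := hP.β_ge.trans_lt hP.β_lt

theorem Params.Valid.β_pos (hP : P.Valid) : 0 < P.β := hP.εH_pos.trans_le hP.β_ge

theorem Params.Valid.μ_pos (hP : P.Valid) : 0 < P.μ := by
  have := hP.εg_pos
  unfold Params.μ; positivity

theorem Params.Valid.cμ_pos (hP : P.Valid) : 0 < P.cμ := mul_pos hP.ζbar_pos hP.μ_pos

theorem Params.Valid.cμ_lt (hP : P.Valid) : P.cμ < P.μ :=
  mul_lt_of_lt_one_left hP.μ_pos hP.ζbar_lt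

theorem Params.Valid.Mμ_nonneg (hP : P.Valid) : 0 ≤ P.Mμ := add_nonneg hP.Mhat_nonneg hP.μ_pos.le

/-- The coefficient of the cubic term in the acceptance analysis. -/
noncomputable def Params.cubic (P : Params) (LH : ℝ) : ℝ :=
  LH + P.η + (2 - P.β) / (1 - P.β) ^ 2

theorem Params.Valid.cubic_pos (hP : P.Valid) {LH : ℝ} (hLH : 0 < LH) : 0 < P.cubic LH := by
  have h1 := hP.η_pos
  have h2 : 0 < 1 - P.β := sub_pos.2 hP.β_lt
  have h3 : 0 < 2 - P.β := by linarith
  unfold Params.cubic; positivity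

/-- Clearing the factor `(1 - β)²` reveals `cubic` as the denominator common to `csol` and `cnc`. -/
theorem Params.Valid.cubic_mul (hP : P.Valid) (LH : ℝ) :
    (LH + P.η) * (1 - P.β) ^ 2 + (2 - P.β) = P.cubic LH * (1 - P.β) ^ 2 := by
  have h2 : 1 - P.β ≠ 0 := (sub_pos.2 hP.β_lt).ne'
  unfold Params.cubic; field_simp

theorem Params.Valid.csol_eq (hP : P.Valid) (LH : ℝ) :
    P.csol LH = min (P.cd LH) (6 * P.θ ^ 2 / P.cubic LH) := by
  have h2 : (1 - P.β) ^ 2 ≠ 0 := pow_ne_zero _ (sub_pos.2 hP.β_lt).ne'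
  unfold Params.csol
  rw [hP.cubic_mul, ← mul_div_mul_right (6 * P.θ ^ 2) (P.cubic LH) h2]
  ring_nf

theorem Params.Valid.cnc_eq (hP : P.Valid) (LH : ℝ) :
    P.cnc LH = min 1 (3 * P.θ / P.cubic LH) := by
  have h2 : (1 - P.β) ^ 2 ≠ 0 := pow_ne_zero _ (sub_pos.2 hP.β_lt).ne'
  unfold Params.cnc
  rw [hP.cubic_mul, ← mul_div_mul_right (3 * P.θ) (P.cubic LH) h2]
  ring_nf

theorem Params.Valid.cd_pos (hP : P.Valid) {LH : ℝ} (hLH : 0 < LH) : 0 < P.cd LH := by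
  have h1 : 0 < 1 - P.ζbar := sub_pos.2 hP.ζbar_lt
  have h2 := hP.ζr_pos
  unfold Params.cd
  refine lt_min (by positivity) (lt_min ?_ (by positivity))
  exact Real.sqrt_pos.2 (by positivity)

theorem Params.Valid.call_pos (hP : P.Valid) {LH : ℝ} (hLH : 0 < LH) : 0 < P.call LH := by
  have h1 := hP.cubic_pos hLH
  have h2 := hP.θ_pos
  unfold Params.call
  rw [hP.csol_eq, hP.cnc_eq]
  exact lt_min (lt_min (hP.cd_pos hLH) (by positivity)) (lt_min one_pos (by positivity))

theorem Params.call_le_one (P : Params) (LH : ℝ) : P.call LH ≤ 1 :=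
  (min_le_right _ _).trans (min_le_left _ _)

end Parameters

/-! ### The two kinds of search direction -/

section Directions

variable {n : ℕ} {P : Params} {f : E n → ℝ} {LH : ℝ} {U : Set (E n)} {t : NormTests} {x : E n}

theorem abs_sgn (s : ℝ) : |sgn s| = 1 := by
  unfold sgn; split_ifs <;> simp

theorem sgn_mul_self (s : ℝ) : sgn s * s = |s| := by
  unfold sgn; split_ifs with h
  · rw [abs_of_neg h]; ring
  · rw [abs_of_nonneg (not_lt.1 h), one_mul]

theorem relative_smul (x : E n) (c : ℝ) (v : E n) : relative x (c • v) = c • relative x v := by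
  simp [relative]

theorem maxStep_eq (P : Params) (x v : E n) : maxStep P x v = P.β / supNorm (relative x v) := rfl

theorem maxStep_nonneg (hP : P.Valid) (x v : E n) : 0 ≤ maxStep P x v :=
  div_nonneg hP.β_pos.le (supNorm_nonneg _)

theorem supNorm_relative_smul_le (hP : P.Valid) {c : ℝ} {v : E n} (hc : |c| ≤ maxStep P x v) :
    supNorm (relative x (c • v)) ≤ P.β := by
  rw [relative_smul, supNorm_smul]
  refine (mul_le_mul_of_nonneg_right hc (supNorm_nonneg _)).trans ?_
  rw [maxStep_eq]
  rcases (supNorm_nonneg (relative x v)).eq_or_lt with h | h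
  · rw [← h, mul_zero]; exact hP.β_pos.le
  · rw [div_mul_cancel₀ _ h.ne']

theorem abs_neg_sgn_mul_min {a b : ℝ} (ha : 0 ≤ a) (hb : 0 ≤ b) (s : ℝ) :
    |-sgn s * min a b| = min a b := by
  rw [abs_mul, abs_neg, abs_sgn, one_mul, abs_of_nonneg (le_min ha hb)]

/-- Every search direction keeps the trial points inside the positive orthant. -/
theorem SearchDir.supNorm_relative_le (hP : P.Valid) {d : E n} (h : SearchDir P t f x d) :
    supNorm (relative x d) ≤ P.β := by
  cases h with
  | nc hx v hv =>
    refine supNorm_relative_smul_le hP ?_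
    rw [abs_neg_sgn_mul_min (by positivity) (maxStep_nonneg hP x v)]
    exact min_le_right _ _
  | sol hx v hv =>
    refine supNorm_relative_smul_le hP ?_
    rw [abs_of_nonneg (le_min zero_le_one (maxStep_nonneg hP x v))]
    exact min_le_right _ _
  | oracle hx v h1 h2 =>
    refine supNorm_relative_smul_le hP ?_
    rw [abs_neg_sgn_mul_min (by positivity) (maxStep_nonneg hP x v)]
    exact min_le_right _ _

theorem callsCG_of_not_firstOrder (h : ¬ FirstOrder f P.εg x) : CallsCG P f x := by
  by_contra hc
  simp only [CallsCG, not_or, not_exists, not_le, not_lt] at hc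
  exact h ⟨fun i => (hc.1 i).le, hc.2⟩

/-- With `ε_g = 4 μ` the barrier term, at most `μ` per coordinate, cannot cancel a violation of size
`ε_g` in the scaled gradient. If instead a component of the gradient of `f` is negative, the barrier
term has the same sign; it alone is `-μ` when `x_i ≤ 1`, and the gradient component alone suffices
otherwise. -/
theorem le_supNorm_sGrad (hP : P.Valid) (hf : ContDiffAt ℝ 2 f x) (hx : ∀ i, 0 < x i)
    (hc : CallsCG P f x) : P.μ ≤ supNorm (sGrad P f x) := by
  have hε := hP.εg_pos
  have hμ : P.εg = 4 * P.μ := by unfold Params.μ; ring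
  suffices ∃ i, P.μ ≤ |sGrad P f x i| by
    obtain ⟨i, hi⟩ := this
    exact hi.trans (abs_apply_le_supNorm _ i)
  rcases hc with ⟨i, hi⟩ | h
  · refine ⟨i, ?_⟩
    rw [sGrad_apply P hf hx]
    refine le_trans ?_ (neg_le_abs _)
    have hxi := hx i
    rcases le_total (x i) 1 with h1 | h1
    · rw [min_eq_left h1, inv_mul_cancel₀ hxi.ne']
      nlinarith
    · rw [min_eq_right h1]
      have : 0 < (x i)⁻¹ := by positivity
      nlinarith [hP.μ_pos]
  · obtain ⟨i, hi⟩ : ∃ i, P.εg < |diag (capped x) (gradient f x) i| := by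
      by_contra! hno
      exact absurd h (not_lt.2 ((supNorm_le_iff hε.le).2 hno))
    refine ⟨i, ?_⟩
    rw [sGrad_apply P hf hx]
    obtain ⟨h1, h2⟩ := ratio_mem hx i
    rw [diag_apply, capped_apply] at hi
    have h3 := abs_sub_abs_le_abs_sub (min (x i) 1 * gradient f x i)
      (P.μ * ((x i)⁻¹ * min (x i) 1))
    rw [abs_of_pos (mul_pos hP.μ_pos h1)] at h3
    nlinarith [hP.μ_pos]

theorem sGrad_ne_zero (hP : P.Valid) (hf : ContDiffAt ℝ 2 f x) (hx : ∀ i, 0 < x i)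
    (hc : CallsCG P f x) : sGrad P f x ≠ 0 := by
  intro h0
  have := le_supNorm_sGrad hP hf hx hc
  rw [h0] at this
  simp only [supNorm, WithLp.ofLp_zero, norm_zero] at this
  exact absurd hP.μ_pos (not_lt.2 this)

theorem exists_searchDir (hP : P.Valid) (hf : ContDiffAt ℝ 2 f x) (hx : ∀ i, 0 < x i)
    (hc : CallsCG P f x) (h : t = .consecutive ∨ ‖hess f x‖ ≤ P.Mhat) :
    ∃ v, SearchDir P t f x v := by
  have hM : t = .consecutive ∨ ‖sHess P f x‖ ≤ P.Mμ :=
    h.imp_right fun h => (norm_sHess_le P hP.μ_pos.le hf hx).trans (add_le_add_left h _)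
  obtain ⟨flag, v, hv⟩ := exists_cappedCG (ζr := P.ζr) (c := P.cμ) (sHess_symm P hf hx)
    (sGrad_ne_zero hP hf hx hc) hP.εH_pos hP.ζr_pos.le hP.cμ_pos.le hP.Mμ_nonneg hM
  cases flag with
  | nc => exact ⟨_, .nc hc v hv⟩
  | sol => exact ⟨_, .sol hc v hv⟩

/-- The norm of a direction that is cut back to the boundary. -/
theorem le_norm_maxStep_smul (hP : P.Valid) (hx : ∀ i, 0 < x i) {v : E n} (hv : v ≠ 0) :
    P.εH ≤ maxStep P x v * ‖v‖ := by
  have h1 := supNorm_relative_pos hx hv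
  have h2 := supNorm_relative_le_norm hx v
  rw [maxStep_eq, div_mul_eq_mul_div, le_div_iff₀ h1]
  have := hP.β_ge
  -- The input condition `β ≥ √ε_g` enters here; the other factor uses that `X⁻¹ X̄` does not
  -- enlarge vectors.
  exact mul_le_mul this h2 h1.le hP.β_pos.le

/-- A direction along which the model has negative curvature. -/
structure IsNegCurv (P : Params) (f : E n → ℝ) (x d : E n) : Prop where
  slope : inner ℝ (sGrad P f x) d ≤ 0
  curv : inner ℝ d (sHess P f x d) ≤ -‖d‖ ^ 3
  le_norm : P.εH ≤ ‖d‖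

/-- A direction obtained from an approximate Newton step. -/
structure IsNewton (P : Params) (f : E n → ℝ) (x d : E n) : Prop where
  ne_zero : d ≠ 0
  decrease : ∀ s ∈ Icc (0 : ℝ) 1, s * inner ℝ (sGrad P f x) d +
    s ^ 2 / 2 * inner ℝ d (sHess P f x d) ≤ -(s * P.εH * ‖d‖ ^ 2)
  residual : P.εH ≤ ‖d‖ ∨ supNorm (damped (sHess P f x) P.εH d + sGrad P f x) ≤ P.cμ

/-- Removing the damping `2 ε` leaves curvature below `-ε ‖v‖²`. Scaling by at most `|q| / ‖v‖³`
makes the curvature at most `-‖d‖³`, and the sign makes the slope nonpositive; whichever term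
attains the minimum, the length is at least `ε_H`. -/
theorem isNegCurv_of_lowCurv (hP : P.Valid) (hx : ∀ i, 0 < x i) {v : E n}
    (hv : LowCurv (damped (sHess P f x) P.εH) P.εH v) :
    IsNegCurv P f x ((-sgn (inner ℝ (sGrad P f x) v) *
      min (|inner ℝ v (sHess P f x v)| / ‖v‖ ^ 3) (maxStep P x v)) • v) := by
  have hε := hP.εH_pos
  have hv0 : v ≠ 0 := by
    rintro rfl
    simp [LowCurv] at hv
  have hn : 0 < ‖v‖ := norm_pos_iff.2 hv0
  rw [LowCurv, inner_damped] at hv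
  set q := inner ℝ v (sHess P f x v)
  have hq : q < -(P.εH * ‖v‖ ^ 2) := by linarith
  have hq0 : q < 0 := hq.trans_le (by nlinarith [sq_nonneg ‖v‖])
  have hm0 : 0 ≤ |q| / ‖v‖ ^ 3 := by positivity
  have habs := abs_neg_sgn_mul_min hm0 (maxStep_nonneg hP x v) (inner ℝ (sGrad P f x) v)
  set m := min (|q| / ‖v‖ ^ 3) (maxStep P x v) with hm
  have hmn : 0 ≤ m := le_min hm0 (maxStep_nonneg hP x v)
  have hnorm : ‖(-sgn (inner ℝ (sGrad P f x) v) * m) • v‖ = m * ‖v‖ := by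
    rw [norm_smul, Real.norm_eq_abs, habs]
  refine ⟨?_, ?_, ?_⟩
  · rw [inner_smul_right]
    have h1 := sgn_mul_self (inner ℝ (sGrad P f x) v)
    have h2 := abs_nonneg (inner ℝ (sGrad P f x) v)
    nlinarith
  · rw [hnorm, map_smul, inner_smul_left, inner_smul_right, conj_trivial, ← mul_assoc,
      ← sq, ← sq_abs, habs]
    have h1 : m * ‖v‖ ^ 3 ≤ |q| := (le_div_iff₀ (by positivity)).1 (min_le_left _ _)
    rw [abs_of_neg hq0] at h1
    change m ^ 2 * q ≤ _
    nlinarith [mul_le_mul_of_nonneg_left h1 (sq_nonneg m)]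
  · rw [hnorm]
    rcases min_choice (|q| / ‖v‖ ^ 3) (maxStep P x v) with h | h
    · rw [hm, h, abs_of_neg hq0, div_mul_eq_mul_div, le_div_iff₀ (by positivity)]
      nlinarith
    · rw [hm, h]; exact le_norm_maxStep_smul hP hx hv0

/-- The CG residual is orthogonal to `y`, so the slope along `y` is minus the damped curvature. The
undamped curvature may be negative, but is at least `-ε ‖y‖²`, and the damping leaves a decrease of
order `ε ‖y‖²`. The residual bound survives only if the step is not cut back; if it is, the step is
long. -/
theorem isNewton_of_sol (hP : P.Valid) (hf : ContDiffAt ℝ 2 f x) (hx : ∀ i, 0 < x i)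
    (hc : CallsCG P f x) {y : E n}
    (h : CappedCG t (sHess P f x) (sGrad P f x) P.εH P.ζr P.cμ P.Mμ .sol y) :
    IsNewton P f x (min 1 (maxStep P x y) • y) := by
  have hε := hP.εH_pos
  obtain ⟨h1, h2, h3⟩ := h.sol_spec (sHess_symm P hf hx) (sGrad_ne_zero hP hf hx hc) hε
    hP.ζr_pos.le hP.cμ_pos.le hP.Mμ_nonneg
  -- For `y = 0` the residual would be the scaled gradient, whose sup norm is at least `μ > c_μ`.
  have hy : y ≠ 0 := by
    rintro rfl
    rw [map_zero, zero_add] at h3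
    exact absurd hP.cμ_lt (not_lt.2 ((le_supNorm_sGrad hP hf hx hc).trans h3))
  have hyn : 0 < ‖y‖ := norm_pos_iff.2 hy
  have hms : 0 < maxStep P x y := div_pos hP.β_pos (supNorm_relative_pos hx hy)
  set α := min 1 (maxStep P x y) with hα
  have hα0 : 0 < α := lt_min one_pos hms
  have hα1 : α ≤ 1 := min_le_left _ _
  refine ⟨smul_ne_zero hα0.ne' hy, ?_, ?_⟩
  · intro s hs
    rw [inner_damped] at h1
    rw [inner_add_left, real_inner_comm, inner_damped] at h2
    rw [map_smul, inner_smul_left, inner_smul_right, inner_smul_right, norm_smul,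
      Real.norm_of_nonneg hα0.le, conj_trivial]
    set q := inner ℝ y (sHess P f x y)
    have hg : inner ℝ (sGrad P f x) y = -(q + 2 * P.εH * ‖y‖ ^ 2) := by linarith
    rw [hg]
    have hsα0 : 0 ≤ s * α := mul_nonneg hs.1 hα0.le
    have hsα1 : s * α ≤ 1 := mul_le_one₀ hs.2 hα0.le hα1
    have h4 : -(1 * (P.εH * ‖y‖ ^ 2)) ≤ (1 - s * α / 2) * q := by
      have h5 : 0 ≤ 1 - s * α / 2 := by linarith
      have h6 := mul_le_mul_of_nonneg_left (by linarith : -(P.εH * ‖y‖ ^ 2) ≤ q) h5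
      have h7 : 0 ≤ P.εH * ‖y‖ ^ 2 := by positivity
      nlinarith
    have h8 := mul_le_mul_of_nonneg_left h4 hsα0
    have h9 : s * P.εH * (α * ‖y‖) ^ 2 ≤ s * α * (P.εH * ‖y‖ ^ 2) := by
      have h7 : 0 ≤ s * α * (P.εH * ‖y‖ ^ 2) := by positivity
      calc _ = α * (s * α * (P.εH * ‖y‖ ^ 2)) := by ring
        _ ≤ _ := mul_le_of_le_one_left h7 hα1
    nlinarith
  · rcases min_choice 1 (maxStep P x y) with h | h
    · right
      rw [hα, h, one_smul]; exact h3
    · left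
      rw [norm_smul, Real.norm_of_nonneg hα0.le, hα, h]
      exact le_norm_maxStep_smul hP hx hy

theorem SearchDir.cases_of_callsCG (hP : P.Valid) (hf : ContDiffAt ℝ 2 f x) (hx : ∀ i, 0 < x i)
    (hc : CallsCG P f x) {d : E n} (h : SearchDir P t f x d) :
    IsNegCurv P f x d ∨ IsNewton P f x d := by
  cases h with
  | nc hx' v hv => exact .inl (isNegCurv_of_lowCurv hP hx hv.lowCurv)
  | sol hx' v hv => exact .inr (isNewton_of_sol hP hf hx hc hv)
  | oracle hx' => exact absurd hc hx'

end Directions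

/-! ### Acceptance of steps and length of the accepted step -/

section LineSearch

variable {n : ℕ} {P : Params} {f : E n → ℝ} {LH : ℝ} {U : Set (E n)} {x d : E n}

/-- The constant `cubic` contains `η`, so negativity of this model already includes the required
decrease `η / 6`. -/
theorem accepts_of_model_neg (hP : P.Valid) (hLH : 0 < LH) (h : LipschitzHessianOn f LH U)
    (hx : ∀ i, 0 < x i) (hseg : trialPath x d ⊆ U) (hd : supNorm (relative x d) ≤ P.β) (j : ℕ)
    (hneg : P.θ ^ j * inner ℝ (sGrad P f x) d + (P.θ ^ j) ^ 2 / 2 * inner ℝ d (sHess P f x d)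
      + (P.θ ^ j) ^ 3 / 6 * P.cubic LH * ‖d‖ ^ 3 < 0) : Accepts P f x d j := by
  have h1 := barrier_step_le hP hLH h hx hseg hd
    ⟨pow_nonneg hP.θ_pos.le j, pow_le_one₀ hP.θ_pos.le hP.θ_lt.le⟩
  unfold Params.cubic at hneg
  unfold Accepts
  nlinarith

/-- The curvature term is at most `-s² ‖d‖³ / 2`, which outweighs the cubic term exactly when `s ·
cubic < 3`. -/
theorem IsNegCurv.accepts (hP : P.Valid) (hLH : 0 < LH) (h : LipschitzHessianOn f LH U)
    (hx : ∀ i, 0 < x i) (hseg : trialPath x d ⊆ U) (hd : supNorm (relative x d) ≤ P.β)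
    (hnc : IsNegCurv P f x d) {j : ℕ} (hj : P.θ ^ j * P.cubic LH < 3) : Accepts P f x d j := by
  refine accepts_of_model_neg hP hLH h hx hseg hd j ?_
  have hs : 0 < P.θ ^ j := pow_pos hP.θ_pos j
  have hn : 0 < ‖d‖ := hP.εH_pos.trans_le hnc.le_norm
  set s := P.θ ^ j
  have h1 := mul_nonpos_of_nonneg_of_nonpos hs.le hnc.slope
  have h2 := mul_le_mul_of_nonneg_left hnc.curv (by positivity : 0 ≤ s ^ 2 / 2)
  have h3 : 0 < s ^ 2 / 6 * ‖d‖ ^ 3 := by positivity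
  nlinarith [mul_lt_mul_of_pos_left hj h3]

theorem IsNewton.accepts (hP : P.Valid) (hLH : 0 < LH) (h : LipschitzHessianOn f LH U)
    (hx : ∀ i, 0 < x i) (hseg : trialPath x d ⊆ U) (hd : supNorm (relative x d) ≤ P.β)
    (hnw : IsNewton P f x d) {j : ℕ} (hj : (P.θ ^ j) ^ 2 * ‖d‖ * P.cubic LH < 6 * P.εH) :
    Accepts P f x d j := by
  refine accepts_of_model_neg hP hLH h hx hseg hd j ?_
  have hs : 0 < P.θ ^ j := pow_pos hP.θ_pos j
  have h1 := hnw.decrease (P.θ ^ j) ⟨hs.le, pow_le_one₀ hP.θ_pos.le hP.θ_lt.le⟩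
  have hn : 0 < ‖d‖ := norm_pos_iff.2 hnw.ne_zero
  set s := P.θ ^ j
  have h3 : 0 < s / 6 * ‖d‖ ^ 2 := by positivity
  nlinarith [mul_lt_mul_of_pos_left hj h3]

theorem exists_lineSearch (h : ∃ j, Accepts P f x d j) : ∃ x', LineSearch P f x d x' := by
  classical
  exact ⟨_, Nat.find h, Nat.find_spec h, fun _ hi => Nat.find_min h hi, rfl⟩

theorem exists_lineSearch_of_cases (hP : P.Valid) (hLH : 0 < LH) (h : LipschitzHessianOn f LH U)
    (hx : ∀ i, 0 < x i) (hseg : trialPath x d ⊆ U) (hd : supNorm (relative x d) ≤ P.β)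
    (hcases : IsNegCurv P f x d ∨ IsNewton P f x d) : ∃ x', LineSearch P f x d x' := by
  have ht := tendsto_pow_atTop_nhds_zero_of_lt_one hP.θ_pos.le hP.θ_lt
  apply exists_lineSearch
  rcases hcases with hc | hc
  · have h1 := ht.mul_const (P.cubic LH)
    rw [zero_mul] at h1
    obtain ⟨j, hj⟩ := (h1.eventually_lt_const (by norm_num : (0 : ℝ) < 3)).exists
    exact ⟨j, hc.accepts hP hLH h hx hseg hd hj⟩
  · have h1 := ((ht.pow 2).mul_const ‖d‖).mul_const (P.cubic LH)
    norm_num at h1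
    obtain ⟨j, hj⟩ := (h1.eventually_lt_const (mul_pos (by norm_num : (0 : ℝ) < 6) hP.εH_pos)).exists
    exact ⟨j, hc.accepts hP hLH h hx hseg hd hj⟩

/-- Either the accepted step is long, or it is a short full Newton step. -/
theorem long_step_or_newton (hP : P.Valid) (hLH : 0 < LH) (h : LipschitzHessianOn f LH U)
    (hx : ∀ i, 0 < x i) (hseg : trialPath x d ⊆ U) (hd : supNorm (relative x d) ≤ P.β)
    (hcases : IsNegCurv P f x d ∨ IsNewton P f x d) {j : ℕ}
    (hmin : ∀ i < j, ¬ Accepts P f x d i) :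
    P.call LH * P.εH ≤ P.θ ^ j * ‖d‖ ∨
      j = 0 ∧ ‖d‖ < P.cd LH * P.εH ∧
        supNorm (damped (sHess P f x) P.εH d + sGrad P f x) ≤ P.cμ := by
  have hε := hP.εH_pos
  have hG := hP.cubic_pos hLH
  have hθ := hP.θ_pos
  have hlong : P.εH ≤ ‖d‖ → P.call LH * P.εH ≤ ‖d‖ := fun h1 =>
    (mul_le_of_le_one_left hε.le (P.call_le_one LH)).trans h1
  rcases hcases with hc | hc
  · left
    cases j with
    | zero => simpa using hlong hc.le_norm
    | succ j =>
      -- Rejection at the previous exponent bounds the accepted `θ^(j+1)` below by `3 θ / cubic`.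
      have h1 : 3 ≤ P.θ ^ j * P.cubic LH :=
        not_lt.1 fun h1 => hmin j (by omega) (hc.accepts hP hLH h hx hseg hd h1)
      have h2 : P.call LH ≤ P.θ ^ (j + 1) := by
        refine (min_le_right _ _).trans ?_
        rw [hP.cnc_eq]
        refine (min_le_right _ _).trans ?_
        rw [div_le_iff₀ hG, pow_succ]
        nlinarith
      exact mul_le_mul h2 hc.le_norm hε.le (by positivity)
  · cases j with
    | zero =>
      rcases hc.residual with h1 | h1
      · left; simpa using hlong h1
      · by_cases h2 : ‖d‖ < P.cd LH * P.εH
        · exact .inr ⟨rfl, h2, h1⟩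
        · left
          rw [pow_zero, one_mul]
          refine le_trans ?_ (not_lt.1 h2)
          exact mul_le_mul_of_nonneg_right ((min_le_left _ _).trans (min_le_left _ _)) hε.le
    | succ j =>
      left
      have h1 : 6 * P.εH ≤ (P.θ ^ j) ^ 2 * ‖d‖ * P.cubic LH :=
        not_lt.1 fun h1 => hmin j (by omega) (hc.accepts hP hLH h hx hseg hd h1)
      have h2 : P.call LH ≤ 6 * P.θ ^ 2 / P.cubic LH := by
        refine (min_le_left _ _).trans ?_
        rw [hP.csol_eq]
        exact min_le_right _ _
      -- The rejected Newton trial controls the square of the step length; as `θ^(j+1) ≤ 1`,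
      -- dropping one factor only enlarges it.
      have h3 : P.θ ^ (j + 1) ≤ 1 := pow_le_one₀ hθ.le hP.θ_lt.le
      calc P.call LH * P.εH ≤ 6 * P.θ ^ 2 / P.cubic LH * P.εH :=
            mul_le_mul_of_nonneg_right h2 hε.le
        _ = P.θ ^ 2 * (6 * P.εH) / P.cubic LH := by ring
        _ ≤ P.θ ^ 2 * ((P.θ ^ j) ^ 2 * ‖d‖ * P.cubic LH) / P.cubic LH := by gcongr
        _ = (P.θ ^ (j + 1)) ^ 2 * ‖d‖ := by field_simp; ring
        _ ≤ P.θ ^ (j + 1) * ‖d‖ := by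
          refine mul_le_mul_of_nonneg_right ?_ (norm_nonneg _)
          rw [sq]
          exact mul_le_of_le_one_left (by positivity) h3

end LineSearch

/-! ### Short full Newton steps reach first-order points -/

section ShortNewtonStep

variable {n : ℕ} {P : Params} {f : E n → ℝ} {LH : ℝ} {U : Set (E n)} {x d : E n}

/-- Bounds for one component of the gradient after a short Newton step. -/
theorem coordinate_bounds {D a G r ρ e u μ ζ δ : ℝ} (hD0 : 0 < D) (hD1 : D ≤ 1) (ha0 : 0 < a)
    (ha1 : a ≤ 1) (haD : a = 1 ∨ D = 1) (hμ : 0 < μ) (hζ0 : 0 < ζ) (hζ1 : ζ < 1)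
    (hu : |a * u| ≤ δ) (hδ : δ ≤ 1 / 9) (hμδ : μ * δ ≤ μ * ((1 - ζ) / 9)) (hr : |r| ≤ μ / 9)
    (hρ : |ρ| ≤ ζ * μ) (he : |e| ≤ 8 / 9 * (1 - ζ) * μ)
    (hG : D * G = D * r + ρ - e + μ * (a * (1 - a * u))) :
    -(4 * μ) ≤ G ∧ |D * G| ≤ 9 / 10 * (4 * μ) := by
  have hr' := abs_le.1 hr
  have hρ' := abs_le.1 hρ
  have he' := abs_le.1 he
  have hu' := abs_le.1 hu
  have hζμ0 : 0 < ζ * μ := mul_pos hζ0 hμ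
  have hζμ : ζ * μ ≤ μ := mul_le_of_le_one_left hμ.le hζ1.le
  have h0 : 0 ≤ μ * (a * (1 - a * u)) := mul_nonneg hμ.le (mul_nonneg ha0.le (by linarith))
  constructor
  · rcases haD with h | h
    · have h1 : μ * (1 - δ) ≤ μ * (a * (1 - a * u)) := by
        refine mul_le_mul_of_nonneg_left ?_ hμ.le
        rw [h] at hu' ⊢; linarith
      have h2 : D * r ≤ D * G := by linarith
      have h3 := le_of_mul_le_mul_left h2 hD0
      linarith
    · rw [h, one_mul, one_mul] at hG
      linarith
  · have h1 : |D * r| ≤ μ / 9 := by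
      rw [abs_mul, abs_of_pos hD0]
      exact (mul_le_of_le_one_left (abs_nonneg _) hD1).trans hr
    have h1' := abs_le.1 h1
    have h2 : μ * (a * (1 - a * u)) ≤ μ * (10 / 9) := by
      refine mul_le_mul_of_nonneg_left ?_ hμ.le
      exact (mul_le_of_le_one_left (by linarith) ha1).trans (by linarith)
    rw [hG, abs_le]
    constructor <;> linarith

/-- A short full Newton step leads to an approximate first-order point. -/
theorem firstOrder_of_short_newton (hP : P.Valid) (hLH : 0 < LH) (h : LipschitzHessianOn f LH U)
    (hx : ∀ i, 0 < x i) (hseg : trialPath x d ⊆ U) (hd : supNorm (relative x d) ≤ P.β)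
    (hshort : ‖d‖ < P.cd LH * P.εH)
    (hres : supNorm (damped (sHess P f x) P.εH d + sGrad P f x) ≤ P.cμ) :
    FirstOrder f P.εg (x + diag (capped x) d) := by
  have hf := h.contDiffAt (hseg (left_mem_segment ℝ _ _))
  have hε := hP.εH_pos
  have hε1 := hP.εH_lt
  have hsq := hP.εH_sq
  have hμ := hP.μ_pos
  have hμε : P.εg = 4 * P.μ := by unfold Params.μ; ring
  have hζ0 := hP.ζbar_pos
  have hζ1 := hP.ζbar_lt
  have hζr := hP.ζr_pos
  set δ := ‖d‖
  have hδ0 : 0 ≤ δ := norm_nonneg _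
  have hδ1 : δ ≤ (1 - P.ζbar) / 9 * P.εH :=
    hshort.le.trans (mul_le_mul_of_nonneg_right (min_le_left _ _) hε.le)
  have hδ3 : δ ≤ 1 / (2 * (LH + 9 / 2 + P.ζr)) * P.εH := hshort.le.trans
    (mul_le_mul_of_nonneg_right ((min_le_right _ _).trans (min_le_right _ _)) hε.le)
  have hδ9 : δ ≤ P.εH / 9 := by nlinarith
  -- From `LH δ ≤ ε_H / 2` and `δ ≤ ε_H / 9` the remainder is at most `ε_H² / 36 = μ / 9`.
  have hL2 : LH / 2 * δ ^ 2 ≤ P.μ / 9 := by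
    have h1 : LH * δ ≤ P.εH / 2 := by
      have : LH * (1 / (2 * (LH + 9 / 2 + P.ζr))) ≤ 1 / 2 := by
        rw [mul_one_div, div_le_iff₀ (by positivity)]; linarith
      nlinarith
    nlinarith
  have hεδ : 2 * P.εH * δ ≤ 8 / 9 * (1 - P.ζbar) * P.μ := by nlinarith
  have hδμ : P.μ * δ ≤ P.μ * ((1 - P.ζbar) / 9) := by
    refine mul_le_mul_of_nonneg_left (hδ1.trans ?_) hμ.le
    exact mul_le_of_le_one_right (by linarith) hε1.le
  have hδl : δ ≤ 1 / 9 := by linarith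
  have hTaylor := norm_gradient_sub_le h hseg (right_mem_Icc.2 zero_le_one)
  rw [one_smul, one_smul, one_pow, mul_one] at hTaylor
  have hw := norm_diag_capped_le hx d
  have hTaylor' : ‖gradient f (x + diag (capped x) d) - gradient f x
      - hess f x (diag (capped x) d)‖ ≤ LH / 2 * δ ^ 2 := hTaylor.trans (by gcongr)
  have key : ∀ i, -(4 * P.μ) ≤ gradient f (x + diag (capped x) d) i ∧
      |min (x i) 1 * gradient f (x + diag (capped x) d) i| ≤ 9 / 10 * (4 * P.μ) := by
    intro i
    have hR := (abs_apply_le_norm _ i).trans hTaylor'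
    have hρ := (abs_apply_le_supNorm _ i).trans hres
    have hdi : |d i| ≤ δ := abs_apply_le_norm d i
    rw [PiLp.add_apply, damped_apply, PiLp.add_apply, PiLp.smul_apply, sHess_apply P hf hx,
      sGrad_apply P hf hx, smul_eq_mul, relative_apply, ← mul_assoc (x i)⁻¹] at hρ
    simp only [PiLp.sub_apply] at hR
    have ha := ratio_mem hx i
    have hD0 : 0 < min (x i) 1 := lt_min (hx i) one_pos
    have hD1 : min (x i) 1 ≤ 1 := min_le_right _ _
    have hxD : (x i)⁻¹ * min (x i) 1 = 1 ∨ min (x i) 1 = 1 := by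
      rcases le_total (x i) 1 with h1 | h1
      · left; rw [min_eq_left h1, inv_mul_cancel₀ (hx i).ne']
      · right; exact min_eq_right h1
    set a := (x i)⁻¹ * min (x i) 1
    set D := min (x i) 1
    set G := gradient f (x + diag (capped x) d) i
    set g := gradient f x i
    set hh := hess f x (diag (capped x) d) i
    set ρ := D * hh + P.μ * a * (a * d i) + 2 * P.εH * d i + (D * g - P.μ * a) with hρdef
    have had : |a * d i| ≤ δ := by
      rw [abs_mul, abs_of_pos ha.1]
      exact (mul_le_of_le_one_left (abs_nonneg _) ha.2).trans hdi
    have hεd : |2 * P.εH * d i| ≤ 8 / 9 * (1 - P.ζbar) * P.μ := by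
      rw [abs_mul, abs_of_pos (by positivity : 0 < 2 * P.εH)]
      exact (mul_le_mul_of_nonneg_left hdi (by positivity)).trans hεδ
    refine coordinate_bounds hD0 hD1 ha.1 ha.2 hxD hμ hζ0 hζ1 had hδl hδμ (hR.trans hL2) hρ
      hεd ?_
    -- The residual coordinate `ρ` replaces gradient plus Hessian term by the barrier term minus
    -- damping; the Taylor remainder is what is left.
    rw [hρdef]; ring
  have hstep : ∀ i, (x + diag (capped x) d) i = x i + min (x i) 1 * d i := fun i => by simp
  have hpos : ∀ i, 0 < (x + diag (capped x) d) i := fun i => by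
    simpa using step_pos hx hP.β_lt hd zero_le_one le_rfl i
  refine ⟨fun i => hμε ▸ (key i).1, (supNorm_le_iff hP.εg_pos.le).2 fun i => ?_⟩
  rw [diag_apply, abs_mul, abs_of_pos (capped_pos hpos i), capped_apply]
  have hdi : d i ≤ 1 / 9 := (le_abs_self _).trans ((abs_apply_le_norm d i).trans hδl)
  -- The scaling has to be taken at the new point; the loss `10/9` is what the `9/10` in `key` was
  -- reserved for.
  have h1 : min ((x + diag (capped x) d) i) 1 ≤ 10 / 9 * min (x i) 1 := by
    rw [hstep]
    have := hx i
    rcases le_total (x i) 1 with h1 | h1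
    · rw [min_eq_left h1]
      refine (min_le_left _ _).trans ?_
      nlinarith
    · rw [min_eq_right h1]
      refine (min_le_right _ _).trans (by norm_num)
  have h2 := (key i).2
  rw [abs_mul, abs_of_pos (lt_min (hx i) one_pos)] at h2
  calc _ ≤ 10 / 9 * min (x i) 1 * |gradient f (x + diag (capped x) d) i| :=
        mul_le_mul_of_nonneg_right h1 (abs_nonneg _)
    _ ≤ P.εg := by linarith

end ShortNewtonStep

end LBNCG

namespace LBNCG

/-! ### Counting iterations -/

section Execution

variable {n : ℕ} {P : Params} {f : E n → ℝ} {LH : ℝ} {U : Set (E n)} {t : NormTests}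
  {x0 : E n} {N : ℕ} {x d : ℕ → E n}

theorem LineSearch.pos (hP : P.Valid) {y v y' : E n} (hy : ∀ i, 0 < y i)
    (hv : SearchDir P t f y v) (h : LineSearch P f y v y') (i : Fin n) : 0 < y' i := by
  obtain ⟨j, -, -, rfl⟩ := h
  exact step_pos hy hP.β_lt (hv.supNorm_relative_le hP) (pow_nonneg hP.θ_pos.le j)
    (pow_le_one₀ hP.θ_pos.le hP.θ_lt.le) i

theorem Execution.pos (hP : P.Valid) (hx0 : ∀ i, 0 < x0 i) (h : Execution P t f x0 N x d) :
    ∀ k ≤ N, ∀ i, 0 < x k i := by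
  intro k
  induction k with
  | zero => intro _; rw [h.1]; exact hx0
  | succ k ih =>
    intro hk
    exact (h.2 k hk).2.pos hP (ih (by omega)) (h.2 k hk).1

/-- An iteration between two points that are not approximately first-order makes progress. -/
theorem iteration_progress (hP : P.Valid) (hLH : 0 < LH) (hlip : LipschitzHessianOn f LH U)
    {y v y' : E n} (hy : ∀ i, 0 < y i) (hv : SearchDir P t f y v) (hls : LineSearch P f y v y')
    (hseg : trialPath y v ⊆ U) (h : ¬ FirstOrder f P.εg y) (h' : ¬ FirstOrder f P.εg y') :
    ∃ s, P.call LH * P.εH ≤ s ∧ ‖y' - y‖ ≤ s ∧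
      barrier f P.μ y' < barrier f P.μ y - P.η / 6 * s ^ 3 := by
  have hf := hlip.contDiffAt (hseg (left_mem_segment ℝ _ _))
  have hc := callsCG_of_not_firstOrder h
  have hd := hv.supNorm_relative_le hP
  obtain ⟨j, hacc, hmin, rfl⟩ := hls
  rcases long_step_or_newton hP hLH hlip hy hseg hd (hv.cases_of_callsCG hP hf hy hc) hmin with
    h1 | ⟨rfl, h1, h2⟩
  · refine ⟨P.θ ^ j * ‖v‖, h1, ?_, ?_⟩
    · rw [add_sub_cancel_left, norm_smul, Real.norm_of_nonneg (pow_nonneg hP.θ_pos.le j)]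
      exact mul_le_mul_of_nonneg_left (norm_diag_capped_le hy v) (pow_nonneg hP.θ_pos.le j)
    · rw [mul_pow, ← mul_assoc]; exact hacc
  · rw [pow_zero, one_smul] at h'
    exact absurd (firstOrder_of_short_newton hP hLH hlip hy hseg hd h1 h2) h'

theorem sum_abs_le (v : E n) : ∑ i, |v i| ≤ √n * ‖v‖ := by
  rw [EuclideanSpace.norm_eq, ← Real.sqrt_mul (by positivity)]
  refine Real.le_sqrt_of_sq_le ?_
  have := sq_sum_le_card_mul_sum_sq (s := Finset.univ) (f := fun i => |v i|)
  simpa using this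

/-- The logarithmic terms grow at most linearly in the distance from the starting point. -/
theorem sum_log_le {ω : ℝ} (hω : 0 < ω) (hx0 : supNorm x0 ≤ ω) {y : E n} (hy : ∀ i, 0 < y i) :
    ∑ i, Real.log (y i) ≤ n * Real.log ω + √n * ‖y - x0‖ / ω := by
  have h : ∀ i, Real.log (y i) ≤ Real.log ω + |(y - x0) i| / ω := by
    intro i
    have h1 := Real.log_le_sub_one_of_pos (div_pos (hy i) hω)
    rw [Real.log_div (hy i).ne' hω.ne'] at h1
    have h2 : x0 i ≤ ω := (le_abs_self _).trans ((abs_apply_le_supNorm _ i).trans hx0)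
    have h3 : y i - x0 i ≤ |(y - x0) i| := le_abs_self _
    have h4 : y i / ω ≤ |(y - x0) i| / ω + 1 := by
      rw [div_add_one hω.ne']
      gcongr
      linarith
    linarith
  calc ∑ i, Real.log (y i) ≤ ∑ i, (Real.log ω + |(y - x0) i| / ω) :=
        Finset.sum_le_sum fun i _ => h i
    _ = n * Real.log ω + (∑ i, |(y - x0) i|) / ω := by
        rw [Finset.sum_add_distrib, ← Finset.sum_div]; simp
    _ ≤ _ := by
        have := sum_abs_le (y - x0)
        gcongr

theorem rpow_neg_three_halves (hP : P.Valid) :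
    P.εg ^ (-(3 / 2) : ℝ) = (P.εH ^ 3)⁻¹ := by
  rw [Real.rpow_neg hP.εg_pos.le, Params.εH, Real.sqrt_eq_rpow, ← Real.rpow_natCast,
    ← Real.rpow_mul hP.εg_pos.le]
  norm_num

/-- The number of iterations that stay away from first-order points is at most `K̄₁`. -/
theorem exists_firstOrder (hP : P.Valid) (hLH : 0 < LH) {flow : ℝ}
    (hflow : ∀ x : E n, (∀ i, 0 < x i) → flow ≤ f x) (hx0 : ∀ i, 0 < x0 i)
    (hrun : Execution P t f x0 N x d) (hpath : ∀ k < N, trialPath (x k) (d k) ⊆ U)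
    (hlip : LipschitzHessianOn f LH U) (hN : K1 P LH x0 (f x0 - flow) + 1 ≤ N) :
    ∃ k ≤ K1 P LH x0 (f x0 - flow) + 1, (∀ i, 0 < x k i) ∧ FirstOrder f P.εg (x k) := by
  by_contra! hno
  have hpos := hrun.pos hP hx0
  have hno' : ∀ k ≤ K1 P LH x0 (f x0 - flow) + 1, ¬ FirstOrder f P.εg (x k) := fun k hk =>
    hno k hk (hpos k (hk.trans hN))
  set K := K1 P LH x0 (f x0 - flow) with hK
  have hε := hP.εH_pos
  have hη := hP.η_pos
  have hμ := hP.μ_pos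
  have hc := hP.call_pos hLH
  set c := P.call LH with hcdef
  -- `S` bounds the path length. The decrease `η s³ / 6` is split into halves: one is at least `η c²
  -- ε_g s / 12`, proportional to the length, the other at least `η c³ ε_H³ / 12`, a fixed amount
  -- per iteration.
  have hstep : ∀ k < K + 1, ∀ S, ‖x k - x0‖ ≤ S →
      barrier f P.μ (x k) ≤
        barrier f P.μ x0 - P.η / 12 * (c ^ 2 * P.εg * S + k * (c ^ 3 * P.εH ^ 3)) →
      ∃ S, ‖x (k + 1) - x0‖ ≤ S ∧ barrier f P.μ (x (k + 1)) <
        barrier f P.μ x0 - P.η / 12 * (c ^ 2 * P.εg * S + (k + 1) * (c ^ 3 * P.εH ^ 3)) := by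
    intro k hk S hS hb
    have hkN : k < N := by omega
    obtain ⟨s, h1, h2, h3⟩ := iteration_progress hP hLH hlip (hpos k hkN.le) (hrun.2 k hkN).1
      (hrun.2 k hkN).2 (hpath k hkN) (hno' k hk.le) (hno' (k + 1) hk)
    refine ⟨S + s, ?_, ?_⟩
    · calc ‖x (k + 1) - x0‖ = ‖(x k - x0) + (x (k + 1) - x k)‖ := by congr 1; abel
        _ ≤ _ := (norm_add_le _ _).trans (add_le_add hS h2)
    · have hce : 0 < c * P.εH := mul_pos hc hε
      have h4 : c ^ 2 * P.εg * s ≤ s ^ 3 := by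
        rw [← hP.εH_sq, ← mul_pow, pow_succ s 2]
        exact mul_le_mul_of_nonneg_right (pow_le_pow_left₀ hce.le h1 2) (hce.le.trans h1)
      have h5 : c ^ 3 * P.εH ^ 3 ≤ s ^ 3 := by
        rw [← mul_pow]; exact pow_le_pow_left₀ hce.le h1 3
      have h6 := mul_le_mul_of_nonneg_left (add_le_add h4 h5) (by positivity : 0 ≤ P.η / 12)
      linarith
  have hind : ∀ k ≤ K, ∃ S, ‖x k - x0‖ ≤ S ∧ barrier f P.μ (x k) ≤
      barrier f P.μ x0 - P.η / 12 * (c ^ 2 * P.εg * S + k * (c ^ 3 * P.εH ^ 3)) := by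
    intro k
    induction k with
    | zero => intro _; exact ⟨0, by simp [hrun.1], by simp [hrun.1]⟩
    | succ k ih =>
      intro hk
      obtain ⟨S, h1, h2⟩ := ih (by omega)
      obtain ⟨S', h3, h4⟩ := hstep k (by omega) S h1 h2
      exact ⟨S', h3, by push_cast; exact h4.le⟩
  obtain ⟨S, h1, h2⟩ := hind K le_rfl
  obtain ⟨S', h3, h4⟩ := hstep K (by omega) S h1 h2
  set ω := omega1 P LH x0 with hω
  -- In dimension zero every point is vacuously first-order.
  have hn0 : 0 < n := by
    rcases Nat.eq_zero_or_pos n with rfl | h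
    · refine absurd ⟨fun i => i.elim0, ?_⟩ (hno' 0 (by omega))
      exact (supNorm_le_iff hP.εg_pos.le).2 fun i => i.elim0
    · exact h
  have hnr : (0 : ℝ) < n := Nat.cast_pos.2 hn0
  have hω1 : 3 * √n / (P.η * c ^ 2) ≤ ω := le_max_left _ _
  have hω0 : 0 < ω := lt_of_lt_of_le (by positivity) hω1
  have hω2 : √n / ω ≤ P.η * c ^ 2 / 3 := by
    rw [div_le_iff₀ (by positivity)] at hω1
    rw [div_le_iff₀ hω0]
    linarith
  have hxm := hpos (K + 1) hN
  have h5 := sum_log_le hω0 (le_max_right _ _ : supNorm x0 ≤ ω) hxm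
  have h6 : √n * ‖x (K + 1) - x0‖ / ω ≤ P.η * c ^ 2 / 3 * S' := by
    rw [mul_div_right_comm]
    exact mul_le_mul hω2 h3 (norm_nonneg _) (by positivity)
  have h7 := hflow _ hxm
  have h8 : n * (⨅ i, Real.log (x0 i)) ≤ ∑ i, Real.log (x0 i) := by
    have : ∑ _i : Fin n, (⨅ i, Real.log (x0 i)) ≤ ∑ i, Real.log (x0 i) :=
      Finset.sum_le_sum fun i _ => ciInf_le (Set.finite_range _).bddBelow i
    simpa using this
  have h9 := mul_le_mul_of_nonneg_left (h5.trans (add_le_add_right h6 _)) hμ.le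
  have h10 := mul_le_mul_of_nonneg_left h8 hμ.le
  -- With `μ = ε_g / 4` and the choice of `ω₁`, the logarithmic growth cancels exactly the half of
  -- the decrease proportional to the path length.
  have h11 : P.μ * (P.η * c ^ 2 / 3 * S') = P.η / 12 * (c ^ 2 * P.εg * S') := by
    unfold Params.μ; ring
  have h12 : P.η / 12 * (((K : ℝ) + 1) * (c ^ 3 * P.εH ^ 3)) <
      P.μ * n * (Real.log ω - ⨅ i, Real.log (x0 i)) + (f x0 - flow) := by
    unfold barrier at h4
    nlinarith
  have h13 : 12 * (P.μ * n * (Real.log ω - ⨅ i, Real.log (x0 i)) + (f x0 - flow)) /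
      (P.η * c ^ 3) * P.εg ^ (-(3 / 2) : ℝ) ≤ K := Nat.le_ceil _
  rw [rpow_neg_three_halves hP, ← div_eq_mul_inv, div_div, div_le_iff₀ (by positivity)] at h13
  have h14 : 0 < P.η * c ^ 3 * P.εH ^ 3 := by positivity
  nlinarith

end Execution

/-! ### Asymptotic order of the bound -/

section Order

/-- The order of `K̄₁` for fixed parameters. -/
theorem K1_isBigO {P : Params} (hP : P.Valid) {LH : ℝ} (hLH : 0 < LH) (lo hi Δ : ℝ)
    (hlo : 0 < lo) :
    ∃ C : ℝ, ∀ ε : ℝ, 0 < ε → ε < 1 → ∀ n : ℕ, 1 ≤ n → ∀ x0 : E n,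
      (∀ i, lo ≤ x0 i ∧ x0 i ≤ hi) → ∀ δ ≤ Δ,
      (K1 { P with εg := ε } LH x0 δ : ℝ) ≤
        C * (n * (1 + Real.log n) * ε ^ (-(1 / 2) : ℝ) + ε ^ (-(3 / 2) : ℝ)) := by
  have hη := hP.η_pos
  have hc := hP.call_pos hLH
  set c := P.call LH with hcdef
  set W := max (3 / (P.η * c ^ 2)) hi with hW
  have hW0 : 0 < W := lt_max_of_lt_left (by positivity)
  set B := |Real.log W| + |Real.log lo| + 1 with hB
  have hB0 : 0 < B := by positivity
  refine ⟨12 / (P.η * c ^ 3) * (B + |Δ|) + 1, ?_⟩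
  intro ε hε hε1 n hn x0 hx0 δ hδ
  have hn1 : (1 : ℝ) ≤ n := Nat.one_le_cast.2 hn
  have hnr : (0 : ℝ) < n := by linarith
  have hlogn : 0 ≤ Real.log n := Real.log_nonneg hn1
  have hsn : 1 ≤ √(n : ℝ) := Real.one_le_sqrt.2 hn1
  have : Nonempty (Fin n) := ⟨⟨0, hn⟩⟩
  set ω := omega1 { P with εg := ε } LH x0 with hω
  have hω1 : 3 * √n / (P.η * c ^ 2) ≤ ω := le_max_left _ _
  have hω0 : 0 < ω := lt_of_lt_of_le (by positivity) hω1
  have hω2 : ω ≤ W * √n := by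
    refine max_le ?_ ?_
    -- The constant `call` does not involve `εg`, so `c` is the same for every `ε`.
    · change 3 * √n / (P.η * c ^ 2) ≤ _
      rw [mul_div_right_comm]
      exact mul_le_mul_of_nonneg_right (le_max_left _ _) (by positivity)
    · refine (supNorm_le_iff (by positivity)).2 fun i => ?_
      rw [abs_of_pos (hlo.trans_le (hx0 i).1)]
      exact ((hx0 i).2.trans (le_max_right _ _)).trans (le_mul_of_one_le_right hW0.le hsn)
  have h1 : Real.log ω ≤ |Real.log W| + Real.log n := by
    refine (Real.log_le_log hω0 hω2).trans ?_
    rw [Real.log_mul hW0.ne' (by positivity), Real.log_sqrt hnr.le]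
    have := le_abs_self (Real.log W)
    linarith
  have h2 : -|Real.log lo| ≤ ⨅ i, Real.log (x0 i) :=
    le_ciInf fun i => (neg_abs_le _).trans (Real.log_le_log hlo (hx0 i).1)
  have h3 : Real.log ω - (⨅ i, Real.log (x0 i)) ≤ B * (1 + Real.log n) := by
    have : 0 ≤ (|Real.log W| + |Real.log lo|) * Real.log n := by positivity
    rw [hB]; nlinarith
  have hr3 : 1 ≤ ε ^ (-(3 / 2) : ℝ) :=
    Real.one_le_rpow_of_pos_of_le_one_of_nonpos hε hε1.le (by norm_num)
  have hr1 : 0 < ε ^ (-(1 / 2) : ℝ) := Real.rpow_pos_of_pos hε _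
  -- The factor `μ = ε / 4` in front of the logarithms improves `ε^(-3/2)` to `ε^(-1/2)` in the term
  -- with `n`.
  have hr13 : ε * ε ^ (-(3 / 2) : ℝ) = ε ^ (-(1 / 2) : ℝ) := by
    rw [← Real.rpow_one_add' hε.le (by norm_num)]; norm_num
  set r1 := ε ^ (-(1 / 2) : ℝ)
  set r3 := ε ^ (-(3 / 2) : ℝ)
  have hmain : 12 * (ε / 4 * n * (Real.log ω - ⨅ i, Real.log (x0 i)) + δ) / (P.η * c ^ 3) * r3 ≤
      12 / (P.η * c ^ 3) * (B + |Δ|) * (n * (1 + Real.log n) * r1 + r3) := by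
    have h4 : ε / 4 * n * (Real.log ω - ⨅ i, Real.log (x0 i)) ≤
        ε * (n * (B * (1 + Real.log n))) := by
      have h5 := mul_le_mul_of_nonneg_left h3 hnr.le
      have h6 : 0 ≤ n * (B * (1 + Real.log n)) := by positivity
      have h7 := mul_le_mul_of_nonneg_left h5 (by positivity : 0 ≤ ε / 4)
      nlinarith
    have h5 : δ ≤ |Δ| := hδ.trans (le_abs_self _)
    have h6 := mul_le_mul_of_nonneg_right (add_le_add h4 h5) (by positivity : 0 ≤ r3)
    have h7 : (ε * (n * (B * (1 + Real.log n))) + |Δ|) * r3 ≤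
        (B + |Δ|) * (n * (1 + Real.log n) * r1 + r3) := by
      have h8 : 0 ≤ B * r3 := by positivity
      have h9 : 0 ≤ |Δ| * (n * (1 + Real.log n) * r1) := by positivity
      rw [← hr13] at h9 ⊢
      nlinarith
    calc _ = 12 / (P.η * c ^ 3) *
          ((ε / 4 * n * (Real.log ω - ⨅ i, Real.log (x0 i)) + δ) * r3) := by ring
      _ ≤ 12 / (P.η * c ^ 3) * ((B + |Δ|) * (n * (1 + Real.log n) * r1 + r3)) :=
          mul_le_mul_of_nonneg_left (h6.trans h7) (by positivity)
      _ = _ := by ring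
  -- The `+ 1` from rounding up is absorbed by `ε^(-3/2) ≥ 1`, which accounts for the summand `1` in
  -- the constant.
  have hceil : (K1 { P with εg := ε } LH x0 δ : ℝ) ≤
      12 / (P.η * c ^ 3) * (B + |Δ|) * (n * (1 + Real.log n) * r1 + r3) + 1 := by
    have h0 : 0 ≤ 12 / (P.η * c ^ 3) * (B + |Δ|) * (n * (1 + Real.log n) * r1 + r3) := by
      positivity
    have h4 : (K1 { P with εg := ε } LH x0 δ : ℝ) ≤
        (⌈12 / (P.η * c ^ 3) * (B + |Δ|) * (n * (1 + Real.log n) * r1 + r3)⌉₊ : ℝ) :=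
      Nat.cast_le.2 (Nat.ceil_le_ceil hmain)
    exact h4.trans (Nat.ceil_lt_add_one h0).le
  have h4 : 0 ≤ n * (1 + Real.log n) * r1 := by positivity
  rw [add_mul, one_mul]
  linarith

end Order

end LBNCG

theorem theorem4p7 (P : LBNCG.Params) (hP : P.Valid) (LH : ℝ) (hLH : 0 < LH) :
    (∀ (n : ℕ) (hn : 1 ≤ n) (f : LBNCG.E n → ℝ) (flow : ℝ)
        (hflow : ∀ x : LBNCG.E n, (∀ i, 0 < x i) → flow ≤ f x)
        (x0 : LBNCG.E n) (hx0 : ∀ i, 0 < x0 i) (t : LBNCG.NormTests)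
        (N : ℕ) (x d : ℕ → LBNCG.E n) (hrun : LBNCG.Execution P t f x0 N x d)
        (U : Set (LBNCG.E n)) (hpath : LBNCG.CoversPath P t f U N x d)
        (hlip : LBNCG.LipschitzHessianOn f LH U),
      (LBNCG.K1 P LH x0 (f x0 - flow) + 1 ≤ N →
        ∃ k ≤ LBNCG.K1 P LH x0 (f x0 - flow) + 1,
          (∀ i, 0 < x k i) ∧ LBNCG.FirstOrder f P.εg (x k)) ∧
      (¬ LBNCG.FirstOrder f P.εg (x N) →
        ((t = .consecutive ∨ ‖LBNCG.hess f (x N)‖ ≤ P.Mhat) →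
          ∃ v, LBNCG.SearchDir P t f (x N) v) ∧
        ∀ v, LBNCG.SearchDir P t f (x N) v → ∃ x', LBNCG.LineSearch P f (x N) v x')) ∧
    (∀ lo hi Δ : ℝ, 0 < lo →
      ∃ C : ℝ, ∀ ε : ℝ, 0 < ε → ε < 1 → ∀ n : ℕ, 1 ≤ n → ∀ x0 : LBNCG.E n,
        (∀ i, lo ≤ x0 i ∧ x0 i ≤ hi) → ∀ δ ≤ Δ,
        (LBNCG.K1 { P with εg := ε } LH x0 δ : ℝ) ≤
          C * (n * (1 + Real.log n) * ε ^ (-(1 / 2) : ℝ) + ε ^ (-(3 / 2) : ℝ))) := by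
  refine ⟨?_, fun lo hi Δ hlo => LBNCG.K1_isBigO hP hLH lo hi Δ hlo⟩
  intro n _ f flow hflow x0 hx0 t N x d hrun U hpath hlip
  refine ⟨LBNCG.exists_firstOrder hP hLH hflow hx0 hrun hpath.1 hlip, fun hno => ?_⟩
  have hpos := hrun.pos hP hx0 N le_rfl
  have hf := hlip.contDiffAt hpath.2.1
  have hc := LBNCG.callsCG_of_not_firstOrder hno
  exact ⟨LBNCG.exists_searchDir hP hf hpos hc, fun v hv =>
    LBNCG.exists_lineSearch_of_cases hP hLH hlip hpos (hpath.2.2 v hv)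
      (hv.supNorm_relative_le hP) (hv.cases_of_callsCG hP hf hpos hc)⟩
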